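/- **Setting.** Alice and Bob hold systems with Hilbert spaces $\mathcal H_A,\mathcal H_B$ (possibly infinite-dimensional, e.g. the Fock spaces of finitely many optical modes), each with an orthonormal basis of eigenvectors of a local total-photon-number operator $\hat N_A$, resp. $\hat N_B$, with eigenvalues in $\{0,1,2,\dots\}$. Let $\Pi^A_n$, $\Pi^B_n$ be the projectors onto the $n$-photon eigenspaces, $\mathcal U_A[\rho]=\sum_n\Pi^A_n\rho\,\Pi^A_n$, $\mathcal U_B[\rho]=\sum_n\Pi^B_n\rho\,\Pi^B_n$, and $\mathcal U_{\rm loc}=\mathcal U_A\otimes\mathcal U_B$. In addition they hold registers with Hilbert spaces $\mathcal R_A,\mathcal R_B$ that are not subject to any superselection rule (the photon number is $0$ on them), with $\dim\mathcal R_A\ge\dim\mathcal H_A$ and $\dim\mathcal R_B\ge\dim\mathcal H_B$, which start in a pure product state $\varrho_{AB}=|a\rangle\langle a|\otimes|b\rangle\langle b|$. An LOCC operation is one implemented by a protocol with finitely many rounds; in each round one party performs a measurement on its side (an instrument: countably many completely positive maps whose sum is trace preserving; the output space may differ from the input space), announces the outcome, and the protocol continues depending on it. A $U(1)$-LOCC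 operation on systems and registers is an LOCC operation obeying the local superselection rule, in either of the following two senses: (a) every local operation of the protocol commutes with the local phase shifts $\rho\mapsto e^{i\phi\hat N}\rho\,e^{-i\phi\hat N}$ for all $\phi$ (intermediate local spaces carry number operators as well); or (b) the total operation commutes with $\mathcal U_{\rm loc}$ (acting as the identity on the registers). For a function $E$ on states with values in $[0,\infty]$ let $$E_{\rm SSR}(\rho_{AB})=\sup_{\mathcal O}\,E\bigl({\rm Tr}_{\rm sys}\,\mathcal O[\rho_{AB}\otimes\varrho_{AB}]\bigr),$$ where $\mathcal O$ ranges over the $U(1)$-LOCC operations on systems and registers, and ${\rm Tr}_{\rm sys}$ is the trace over $\mathcal H_A\otimes\mathcal H_B$. **Theorem.** Let $\rho_{AB}$ be any density operator on $\mathcal H_A\otimes\mathcal H_B$. For each of the two senses (a), (b) of $U(1)$-LOCC: 1. For every function $E$ from the states of the registers to $[0,\infty]$, $$E_{\rm SSR}(\rho_{AB})=\sup_{\mathcal E}\,E\bigl({\rm Tr}_{\rm sys}\,\mathcal E\bigl[\mathcal U_{\rm loc}[\rho_{AB}]\otimes\varrho_{AB}\bigr]\bigr),$$ where $\mathcal E$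 ranges over all (unconstrained) LOCC operations on systems and registers. 2. If $E$ is an entanglement measure, that is, a $[0,\infty]$-valued function defined on the states of all bipartite systems that does not increase under LOCC, then $$E_{\rm SSR}(\rho_{AB})=E\bigl(\mathcal U_A\otimes\mathcal U_B[\rho_{AB}]\bigr),$$ and the supremum defining $E_{\rm SSR}(\rho_{AB})$ is a maximum. 3. In particular the conclusion of 2 holds when $E$ is the entanglement of distillation, i.e. the supremum of all $R\ge 0$ for which there are LOCC operations turning $n$ copies of a state into $\lfloor Rn\rfloor$ ebits (a maximally entangled state of local dimension $2^{\lfloor Rn\rfloor}$) with fidelity tending to $1$ as $n\to\infty$. -/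

import Mathlib

open scoped ENNReal ComplexOrder lp

noncomputable section

namespace SSR

/-! ### Trace-class operators on `ℓ²(ι)`

The Hilbert space with orthonormal basis indexed by `ι` is `ℓ²(ι, ℂ)`; `ι` may be infinite.
Operators are written as matrices in that basis. -/

/-- A positive trace-class operator: a positive semidefinite matrix (`ι` may be infinite) whose
diagonal is summable. -/
def IsPosTC {ι : Type} (M : Matrix ι ι ℂ) : Prop :=
  M.PosSemidef ∧ Summable fun i => M i i

/-- The trace-class operators on `ℓ²(ι)`: the linear span of the positive ones. -/
def TraceClass (ι : Type) : Submodule ℂ (Matrix ι ι ℂ) :=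
  Submodule.span ℂ {M | IsPosTC M}

theorem IsPosTC.mem {ι : Type} {M : Matrix ι ι ℂ} (h : IsPosTC M) : M ∈ TraceClass ι :=
  Submodule.subset_span h

/-- A linear map of matrices that sends positive trace-class operators to trace-class operators
preserves the trace class. -/
theorem map_mem {ι κ : Type} (f : Matrix ι ι ℂ →ₗ[ℂ] Matrix κ κ ℂ)
    (hf : ∀ M, IsPosTC M → f M ∈ TraceClass κ) {M : Matrix ι ι ℂ} (hM : M ∈ TraceClass ι) :
    f M ∈ TraceClass κ := by
  have h : TraceClass ι ≤ (TraceClass κ).comap f := Submodule.span_le.mpr hf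
  exact h hM

theorem posSemidef_combine {ι κ : Type} {M : Matrix ι ι ℂ} (hM : M.PosSemidef) (f g : κ → ι)
    (c : ℂ) : (M.submatrix f f + c • M.submatrix f g + star c • M.submatrix g f
      + (star c * c) • M.submatrix g g).PosSemidef := by
  refine ⟨?_, fun x => ?_⟩
  · ext x y
    have e := fun i j => hM.1.apply i j
    simp only [Matrix.conjTranspose_apply, Matrix.add_apply, Matrix.smul_apply,
      Matrix.submatrix_apply, smul_eq_mul, star_add, star_mul', star_star, e]
    ring
  · have h := hM.2 (x.mapDomain f + (c • x).mapDomain g)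
    have e1 : ∀ (L : ι → ℂ →+ ℂ), ((x.mapDomain f + (c • x).mapDomain g).sum fun i w => L i w)
        = x.sum fun i w => L (f i) w + L (g i) (c * w) := by
      intro L
      rw [Finsupp.sum_add_index' (by simp) (by simp), Finsupp.sum_mapDomain_index (by simp) (by simp),
        Finsupp.sum_mapDomain_index (by simp) (by simp), Finsupp.sum_smul_index (by simp),
        ← Finsupp.sum_add]
    have e2 : ∀ i w, ((x.mapDomain f + (c • x).mapDomain g).sum fun j v => star w * M i j * v)
        = star w * x.sum fun j v => M i (f j) * v + M i (g j) * (c * v) := by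
      intro i w
      have := e1 fun j => (AddMonoidHom.mulLeft (star w * M i j))
      simp only [AddMonoidHom.coe_mulLeft] at this
      rw [this]
      simp only [Finsupp.sum, Finset.mul_sum]
      exact Finset.sum_congr rfl fun j _ => by ring
    have e3 := e1 fun i => (AddMonoidHom.mulRight
      (x.sum fun j v => M i (f j) * v + M i (g j) * (c * v))).comp (starAddEquiv : ℂ ≃+ ℂ).toAddMonoidHom
    simp only [e2] at h
    refine h.trans_eq (e3.trans ?_)
    refine Finsupp.sum_congr fun i _ => ?_
    simp only [Finsupp.sum, Finset.mul_sum, ← Finset.sum_add_distrib, AddMonoidHom.comp_apply,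
      AddMonoidHom.coe_mulRight, AddEquiv.toAddMonoidHom_eq_coe, AddMonoidHom.coe_coe,
      starAddEquiv_apply]
    refine Finset.sum_congr rfl fun j _ => ?_
    simp only [star_mul', Matrix.add_apply, Matrix.smul_apply,
      Matrix.submatrix_apply, smul_eq_mul]
    ring

/-- Corners `(⟨f x| M |g y⟩)` of a trace-class operator are trace class. -/
theorem submatrix_mem {ι κ : Type} {M : Matrix ι ι ℂ} (hM : M ∈ TraceClass ι) {f g : κ → ι}
    (hf : f.Injective) (hg : g.Injective) : M.submatrix f g ∈ TraceClass κ := by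
  let F : Matrix ι ι ℂ →ₗ[ℂ] Matrix κ κ ℂ :=
    { toFun := fun M => M.submatrix f g
      map_add' := fun _ _ => rfl
      map_smul' := fun _ _ => rfl }
  refine map_mem F (fun M hM => ?_) hM
  let P : ℂ → Matrix κ κ ℂ := fun c => M.submatrix f f + c • M.submatrix f g
      + star c • M.submatrix g f + (star c * c) • M.submatrix g g
  have hP : ∀ c, (P c).PosSemidef := posSemidef_combine hM.1 f g
  have hPs : ∀ c : ℂ, P c ∈ TraceClass κ := by
    intro c
    refine IsPosTC.mem ⟨hP c, ?_⟩
    have hs : Summable fun x => 2 * (M (f x) (f x) + star c * c * M (g x) (g x)) :=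
      ((hM.2.comp_injective hf).add ((hM.2.comp_injective hg).mul_left _)).mul_left 2
    refine Summable.of_norm_bounded (Complex.hasSum_re hs.hasSum).summable fun x => ?_
    have h1 : 0 ≤ P c x x := (hP c).diag_nonneg
    have h2 : 0 ≤ P (-c) x x := (hP (-c)).diag_nonneg
    have h3 : P c x x + P (-c) x x = 2 * (M (f x) (f x) + star c * c * M (g x) (g x)) := by
      simp only [P, star_neg, Matrix.add_apply, Matrix.smul_apply, Matrix.submatrix_apply,
        smul_eq_mul]
      ring
    rw [← h3, Complex.add_re, Complex.norm_eq_sqrt_sq_add_sq, ← (Complex.le_def.mp h1).2]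
    have h4 : 0 ≤ (P c x x).re := (Complex.le_def.mp h1).1
    have h5 : 0 ≤ (P (-c) x x).re := (Complex.le_def.mp h2).1
    simpa [Real.sqrt_sq h4] using h5
  have key : F M = (1 / 4 : ℂ) • (P 1 - P (-1) - Complex.I • P Complex.I
      + Complex.I • P (-Complex.I)) := by
    have hF : F M = M.submatrix f g := rfl
    rw [hF]
    ext x y
    simp only [P, Matrix.submatrix_apply, Matrix.smul_apply,
      Matrix.add_apply, Matrix.sub_apply, smul_eq_mul, Complex.star_def, map_one, map_neg,
      Complex.conj_I]
    linear_combination ((1 / 2 : ℂ) * M (f x) (g y) - (1 / 2 : ℂ) * M (g x) (f y)) * Complex.I_sq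
  rw [key]
  exact Submodule.smul_mem _ _ (Submodule.add_mem _ (Submodule.sub_mem _ (Submodule.sub_mem _
    (hPs _) (hPs _)) (Submodule.smul_mem _ _ (hPs _))) (Submodule.smul_mem _ _ (hPs _)))

theorem summable_diag {ι : Type} {M : Matrix ι ι ℂ} (hM : M ∈ TraceClass ι) :
    Summable fun i => M i i := by
  induction hM using Submodule.span_induction with
  | mem M h => exact h.2
  | zero => exact summable_zero
  | add M M' _ _ h h' => exact h.add h'
  | smul c M _ h => exact h.mul_left c

theorem hadamard_mem {ι : Type} {M B : Matrix ι ι ℂ} (hM : M ∈ TraceClass ι)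
    (hB : B.PosSemidef) (hB1 : ∀ i, B i i = 1) : Matrix.hadamard M B ∈ TraceClass ι := by
  let F : Matrix ι ι ℂ →ₗ[ℂ] Matrix ι ι ℂ :=
    { toFun := fun M => Matrix.hadamard M B
      map_add' := fun _ _ => Matrix.add_hadamard _ _ _
      map_smul' := fun _ _ => Matrix.smul_hadamard _ _ _ }
  refine map_mem F (fun M hM => IsPosTC.mem ⟨hM.1.hadamard hB, ?_⟩) hM
  simpa [F, hB1] using hM.2

theorem posSemidef_rankOne {ι : Type} (v : ι → ℂ) :
    (Matrix.of fun i j => v i * star (v j)).PosSemidef := by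
  refine ⟨?_, fun x => ?_⟩
  · ext i j
    simp [mul_comm]
  · have h : (x.sum fun i xi => x.sum fun j xj =>
        star xi * (Matrix.of fun i j => v i * star (v j)) i j * xj)
        = star (x.sum fun j xj => star (v j) * xj) * (x.sum fun j xj => star (v j) * xj) := by
      simp only [Finsupp.sum, star_sum, Finset.sum_mul, Finset.mul_sum, Matrix.of_apply, star_mul',
        star_star]
      rw [Finset.sum_comm]
      exact Finset.sum_congr rfl fun i _ => Finset.sum_congr rfl fun j _ => by ring
    rw [h]
    exact star_mul_self_nonneg _

/-- Superoperators: linear maps between spaces of trace-class operators. -/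
abbrev SuperOp (α β : Type) : Type := TraceClass α →ₗ[ℂ] TraceClass β

/-- The trace. -/
def trace {ι : Type} : TraceClass ι →ₗ[ℂ] ℂ where
  toFun ρ := ∑' i, ρ.1 i i
  map_add' ρ σ := (summable_diag ρ.2).tsum_add (summable_diag σ.2)
  map_smul' _ ρ := tsum_mul_left (f := fun i => ρ.1 i i)

/-- Density operators. -/
def IsState {ι : Type} (ρ : TraceClass ι) : Prop :=
  ρ.1.PosSemidef ∧ trace ρ = 1

/-- The pure state `|ψ⟩⟨ψ|` (for a unit vector `ψ`). -/
def pureState {ι : Type} (ψ : ℓ²(ι, ℂ)) : TraceClass ι :=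
  ⟨Matrix.of fun i j => ψ i * star (ψ j), IsPosTC.mem ⟨posSemidef_rankOne _, by
    have h := lp.summable_inner (𝕜 := ℂ) ψ ψ
    simp only [RCLike.inner_apply] at h
    exact h⟩⟩

/-- Relabelling of the basis. -/
def reindex {ι κ : Type} (e : κ ≃ ι) : SuperOp ι κ where
  toFun ρ := ⟨ρ.1.submatrix e e, submatrix_mem ρ.2 e.injective e.injective⟩
  map_add' _ _ := rfl
  map_smul' _ _ := rfl

theorem kronecker_mem {α β : Type} {M : Matrix α α ℂ} {M' : Matrix β β ℂ}
    (hM : M ∈ TraceClass α) (hM' : M' ∈ TraceClass β) :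
    Matrix.kronecker M M' ∈ TraceClass (α × β) := by
  let B := Matrix.kroneckerBilinear (R := ℂ) (α := ℂ) (l := α) (m := α) (n := β) (p := β)
  have h1 : ∀ N, IsPosTC N → B N M' ∈ TraceClass (α × β) := fun N hN =>
    map_mem (B N) (fun N' hN' => IsPosTC.mem
      ⟨(hN.1.submatrix Prod.fst).hadamard (hN'.1.submatrix Prod.snd),
        summable_mul_of_summable_norm (f := fun a => N a a) (g := fun b => N' b b)
          hN.2.norm hN'.2.norm⟩) hM'
  exact map_mem (B.flip M') h1 hM

/-- The tensor product `ρ ⊗ σ`. -/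
def tensor {α β : Type} (ρ : TraceClass α) (σ : TraceClass β) : TraceClass (α × β) :=
  ⟨Matrix.kronecker ρ.1 σ.1, kronecker_mem ρ.2 σ.2⟩

theorem summable_ptrace {α β : Type} {M : Matrix (α × β) (α × β) ℂ}
    (hM : M ∈ TraceClass (α × β)) (b b' : β) : Summable fun a => M (a, b) (a, b') :=
  summable_diag (submatrix_mem hM (Prod.mk_left_injective b) (Prod.mk_left_injective b'))

/-- The partial trace over the first tensor factor. -/
def ptraceFst {α β : Type} : SuperOp (α × β) β where
  toFun ρ := ⟨Matrix.of fun b b' => ∑' a, ρ.1 (a, b) (a, b'), by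
    obtain ⟨ρ, hρ⟩ := ρ
    induction hρ using Submodule.span_induction with
    | mem M hM =>
      refine IsPosTC.mem ⟨⟨?_, fun x => ?_⟩, ?_⟩
      · ext b b'
        simp only [Matrix.conjTranspose_apply, Matrix.of_apply]
        refine (tsum_star (f := fun a => M (a, b') (a, b))).trans ?_
        exact tsum_congr fun a => hM.1.1.apply _ _
      · have h : HasSum (fun a => x.sum fun i xi => x.sum fun j xj =>
            star xi * M (a, i) (a, j) * xj) (x.sum fun i xi => x.sum fun j xj =>
            star xi * (∑' a, M (a, i) (a, j)) * xj) :=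
          hasSum_sum fun i _ => hasSum_sum fun j _ =>
            (((summable_ptrace hM.mem i j).hasSum).mul_left _).mul_right _
        exact h.nonneg fun a => (hM.1.submatrix (fun b => (a, b))).2 x
      · exact (hM.2.comp_injective Prod.swap_injective).prod
    | zero => convert Submodule.zero_mem _; ext; simp
    | add M M' hM hM' h h' =>
      convert Submodule.add_mem _ h h'
      ext b b'
      exact (summable_ptrace hM b b').tsum_add (summable_ptrace hM' b b')
    | smul c M _ h =>
      convert Submodule.smul_mem _ c h
      ext b b'
      exact tsum_mul_left⟩
  map_add' ρ σ := by
    ext b b'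
    exact (summable_ptrace ρ.2 b b').tsum_add (summable_ptrace σ.2 b b')
  map_smul' c ρ := by
    ext b b'
    exact tsum_mul_left

/-! ### Phase shifts and the twirl -/

/-- The phase shift `ρ ↦ U(φ) ρ U(φ)†`, `U(φ) = exp(i φ N̂)`, where the number operator `N̂` has
eigenvalue `N i` on the basis vector `i`. -/
def phase {ι : Type} (N : ι → ℕ) (φ : ℝ) : SuperOp ι ι where
  toFun ρ := ⟨Matrix.of fun i j => Complex.exp (Complex.I * φ * N i) * ρ.1 i j *
      star (Complex.exp (Complex.I * φ * N j)), by
    have h := hadamard_mem ρ.2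
      (posSemidef_rankOne fun i => Complex.exp (Complex.I * φ * N i)) fun i => by
        simp [Complex.mul_conj, Complex.normSq_eq_norm_sq, Complex.norm_exp]
    convert h using 1
    ext i j
    simp only [Matrix.of_apply, Matrix.hadamard_apply]
    ring⟩
  map_add' ρ σ := by
    ext i j
    simp [mul_add, add_mul]
  map_smul' c ρ := by
    ext i j
    simp only [Matrix.of_apply, SetLike.val_smul, Matrix.smul_apply, smul_eq_mul, RingHom.id_apply]
    ring

theorem twirl_apply {ι : Type} (N : ι → ℕ) (M : Matrix ι ι ℂ) (i j : ι) :
    (∑' n : ℕ, (if N i = n then 1 else 0) * M i j * (if N j = n then 1 else 0))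
      = if N i = N j then M i j else 0 := by
  rw [tsum_eq_single (N i) (by intro n hn; simp [Ne.symm hn])]
  simp [eq_comm]

/-- The twirl `𝒰[ρ] = ∑ₙ Πₙ ρ Πₙ`, where `Πₙ` projects onto the span of the basis vectors `i` with
`N i = n`. -/
def twirl {ι : Type} (N : ι → ℕ) : SuperOp ι ι where
  toFun ρ := ⟨Matrix.of fun i j =>
      ∑' n : ℕ, (if N i = n then 1 else 0) * ρ.1 i j * (if N j = n then 1 else 0), by
    have h := hadamard_mem ρ.2
      ((Matrix.PosSemidef.one (R := ℂ) (n := ℕ)).submatrix N) fun i => by simp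
    convert h using 1
    ext i j
    rw [Matrix.of_apply, twirl_apply]
    simp [Matrix.hadamard_apply, Matrix.one_apply]⟩
  map_add' ρ σ := by
    ext i j
    simp only [Matrix.of_apply, twirl_apply, Submodule.coe_add, Matrix.add_apply]
    by_cases h : N i = N j <;> simp [h]
  map_smul' c ρ := by
    ext i j
    simp only [Matrix.of_apply, twirl_apply, SetLike.val_smul, Matrix.smul_apply, smul_eq_mul,
      RingHom.id_apply]
    by_cases h : N i = N j <;> simp [h]

/-- `𝒰_A ⊗ 𝒰_B` on a bipartite system. The projectors `Πₙ ⊗ 1` and `1 ⊗ Πₘ` are the spectral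
projectors of the local number operators `N_A ⊗ 1` and `1 ⊗ N_B`. -/
def twirlLoc {α β : Type} (NA : α → ℕ) (NB : β → ℕ) : SuperOp (α × β) (α × β) :=
  twirl (fun x => NA x.1) ∘ₗ twirl (fun x => NB x.2)

/-! ### Local operations and classical communication -/

/-- The block `⟨b| ρ |b'⟩`, a trace-class operator on the first factor. -/
def blockA {α β : Type} (ρ : TraceClass (α × β)) (b b' : β) : TraceClass α :=
  ⟨ρ.1.submatrix (fun a => (a, b)) (fun a => (a, b')),
    submatrix_mem ρ.2 (Prod.mk_left_injective b) (Prod.mk_left_injective b')⟩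

/-- The block `⟨a| ρ |a'⟩`, a trace-class operator on the second factor. -/
def blockB {α β : Type} (ρ : TraceClass (α × β)) (a a' : α) : TraceClass β :=
  ⟨ρ.1.submatrix (fun b => (a, b)) (fun b => (a', b)),
    submatrix_mem ρ.2 (Prod.mk_right_injective a) (Prod.mk_right_injective a')⟩

/-- Complete positivity: `E ⊗ id` on `α × Fin n` preserves positivity for every `n`. -/
def IsCP {α α' : Type} (E : SuperOp α α') : Prop :=
  ∀ (n : ℕ) (ρ : TraceClass (α × Fin n)), ρ.1.PosSemidef →
    (Matrix.of fun x y : α' × Fin n => (E (blockA ρ x.2 y.2)).1 x.1 y.1).PosSemidef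

/-- A measurement with countably many outcomes (unused outcomes have `E k = 0`): completely
positive maps whose sum is trace preserving. -/
def IsInstrument {α α' : Type} (E : ℕ → SuperOp α α') : Prop :=
  (∀ k, IsCP (E k)) ∧ ∀ ρ, HasSum (fun k => trace (E k ρ)) (trace ρ)

/-- `F = E ⊗ id`. -/
def ActsOnA {α α' β : Type} (E : SuperOp α α') (F : SuperOp (α × β) (α' × β)) : Prop :=
  ∀ ρ x y, (F ρ).1 x y = (E (blockA ρ x.2 y.2)).1 x.1 y.1

/-- `F = id ⊗ E`. -/
def ActsOnB {α β β' : Type} (E : SuperOp β β') (F : SuperOp (α × β) (α × β')) : Prop :=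
  ∀ ρ x y, (F ρ).1 x y = (E (blockB ρ x.1 y.1)).1 x.2 y.2

/-- `G = ∑ₖ Fₖ` (entrywise on every trace-class operator). -/
def IsSumOf {α β : Type} (F : ℕ → SuperOp α β) (G : SuperOp α β) : Prop :=
  ∀ ρ x y, HasSum (fun k => (F k ρ).1 x y) ((G ρ).1 x y)

/-- `LOCCRounds α' β' r α β G`: the superoperator `G` from the bipartite system `α × β` to
`α' × β'` is implemented by a protocol of at most `r` rounds. In a round one party performs a
measurement on its part (which may change its local Hilbert space, so local ancillas are included),
announces the outcome `k`, and the protocol continues in a way that depends on `k`. Outcomes are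
forgotten at the end. -/
inductive LOCCRounds (α' β' : Type) :
    ℕ → (α β : Type) → SuperOp (α × β) (α' × β') → Prop
  | done (r : ℕ) : LOCCRounds α' β' r α' β' LinearMap.id
  | alice {r : ℕ} {α α₁ β : Type} (E : ℕ → SuperOp α α₁) (Ê : ℕ → SuperOp (α × β) (α₁ × β))
      (F : ℕ → SuperOp (α₁ × β) (α' × β')) (G : SuperOp (α × β) (α' × β'))
      (hE : IsInstrument E) (hÊ : ∀ k, ActsOnA (E k) (Ê k))
      (hF : ∀ k, LOCCRounds α' β' r α₁ β (F k)) (hG : IsSumOf (fun k => F k ∘ₗ Ê k) G) :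
      LOCCRounds α' β' (r + 1) α β G
  | bob {r : ℕ} {α β β₁ : Type} (E : ℕ → SuperOp β β₁) (Ê : ℕ → SuperOp (α × β) (α × β₁))
      (F : ℕ → SuperOp (α × β₁) (α' × β')) (G : SuperOp (α × β) (α' × β'))
      (hE : IsInstrument E) (hÊ : ∀ k, ActsOnB (E k) (Ê k))
      (hF : ∀ k, LOCCRounds α' β' r α β₁ (F k)) (hG : IsSumOf (fun k => F k ∘ₗ Ê k) G) :
      LOCCRounds α' β' (r + 1) α β G

/-- Unconstrained LOCC. -/
def IsLOCC {α β α' β' : Type} (G : SuperOp (α × β) (α' × β')) : Prop :=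
  ∃ r, LOCCRounds α' β' r α β G

/-- `E` is a `U(1)`-invariant operation: it commutes with all phase shifts. -/
def IsU1Invariant {α α' : Type} (N : α → ℕ) (N' : α' → ℕ) (E : SuperOp α α') : Prop :=
  ∀ φ : ℝ, E ∘ₗ phase N φ = phase N' φ ∘ₗ E

/-- LOCC protocols in which every local operation is `U(1)`-invariant. All spaces, also the
intermediate ones, carry a local photon number (which is `0` on unrestricted registers). -/
inductive U1LOCCRounds {α' β' : Type} (NA' : α' → ℕ) (NB' : β' → ℕ) :
    ℕ → {α β : Type} → (α → ℕ) → (β → ℕ) → SuperOp (α × β) (α' × β') → Prop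
  | done (r : ℕ) : U1LOCCRounds NA' NB' r NA' NB' LinearMap.id
  | alice {r : ℕ} {α α₁ β : Type} {NA : α → ℕ} {NA₁ : α₁ → ℕ} {NB : β → ℕ}
      (E : ℕ → SuperOp α α₁) (Ê : ℕ → SuperOp (α × β) (α₁ × β))
      (F : ℕ → SuperOp (α₁ × β) (α' × β')) (G : SuperOp (α × β) (α' × β'))
      (hE : IsInstrument E) (hU : ∀ k, IsU1Invariant NA NA₁ (E k))
      (hÊ : ∀ k, ActsOnA (E k) (Ê k))
      (hF : ∀ k, U1LOCCRounds NA' NB' r NA₁ NB (F k)) (hG : IsSumOf (fun k => F k ∘ₗ Ê k) G) :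
      U1LOCCRounds NA' NB' (r + 1) NA NB G
  | bob {r : ℕ} {α β β₁ : Type} {NA : α → ℕ} {NB : β → ℕ} {NB₁ : β₁ → ℕ}
      (E : ℕ → SuperOp β β₁) (Ê : ℕ → SuperOp (α × β) (α × β₁))
      (F : ℕ → SuperOp (α × β₁) (α' × β')) (G : SuperOp (α × β) (α' × β'))
      (hE : IsInstrument E) (hU : ∀ k, IsU1Invariant NB NB₁ (E k))
      (hÊ : ∀ k, ActsOnB (E k) (Ê k))
      (hF : ∀ k, U1LOCCRounds NA' NB' r NA NB₁ (F k)) (hG : IsSumOf (fun k => F k ∘ₗ Ê k) G) :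
      U1LOCCRounds NA' NB' (r + 1) NA NB G

/-! ### Systems with registers

Alice holds a system `SA` with photon numbers `NA` and an unrestricted register `RA`; Bob holds
`SB`, `NB` and `RB`. -/

section Registers

variable {SA SB RA RB : Type}

/-- All LOCC operations on systems and registers. -/
def unconstrainedLOCC (SA SB RA RB : Type) :
    Set (SuperOp ((SA × RA) × (SB × RB)) ((SA × RA) × (SB × RB))) :=
  {O | IsLOCC O}

/-- The LOCC operations on systems and registers that commute with `𝒰_A ⊗ 𝒰_B` (the twirl acts on
the systems only). -/
def commutingLOCC (NA : SA → ℕ) (NB : SB → ℕ) (RA RB : Type) :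
    Set (SuperOp ((SA × RA) × (SB × RB)) ((SA × RA) × (SB × RB))) :=
  {O | IsLOCC O ∧
    O ∘ₗ twirlLoc (fun x : SA × RA => NA x.1) (fun x : SB × RB => NB x.1)
      = twirlLoc (fun x : SA × RA => NA x.1) (fun x : SB × RB => NB x.1) ∘ₗ O}

/-- The operations on systems and registers composed of local `U(1)`-invariant operations and
classical communication. -/
def u1LOCC (NA : SA → ℕ) (NB : SB → ℕ) (RA RB : Type) :
    Set (SuperOp ((SA × RA) × (SB × RB)) ((SA × RA) × (SB × RB))) :=
  {O | ∃ r, U1LOCCRounds (fun x : SA × RA => NA x.1) (fun x : SB × RB => NB x.1) r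
    (fun x : SA × RA => NA x.1) (fun x : SB × RB => NB x.1) O}

/-- `ρ_AB ⊗ σ_AB`, regrouped so that Alice's two factors come first. -/
def tensorBip (ρ : TraceClass (SA × SB)) (σ : TraceClass (RA × RB)) :
    TraceClass ((SA × RA) × (SB × RB)) :=
  reindex (Equiv.prodProdProdComm SA RA SB RB) (tensor ρ σ)

/-- The partial trace over the systems. -/
def traceSys : SuperOp ((SA × RA) × (SB × RB)) (RA × RB) :=
  ptraceFst ∘ₗ reindex (Equiv.prodProdProdComm SA RA SB RB).symm

/-- The amounts of entanglement, measured by `E`, that operations from the class `C` produce between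
the registers, when the systems are in the state `ρ` and the registers start in `|a⟩⟨a| ⊗ |b⟩⟨b|`. -/
def producible (E : TraceClass (RA × RB) → ℝ≥0∞)
    (C : Set (SuperOp ((SA × RA) × (SB × RB)) ((SA × RA) × (SB × RB))))
    (a : ℓ²(RA, ℂ)) (b : ℓ²(RB, ℂ)) (ρ : TraceClass (SA × SB)) : Set ℝ≥0∞ :=
  {e | ∃ O ∈ C, e = E (traceSys (O (tensorBip ρ (tensor (pureState a) (pureState b)))))}

/-- The maximal (supremal) entanglement that operations from the class `C` produce between the
registers. For the `U(1)`-invariant LOCC operations this is `E_SSR(ρ)`, the entanglement in the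
presence of the superselection rule. -/
def maxEnt (E : TraceClass (RA × RB) → ℝ≥0∞)
    (C : Set (SuperOp ((SA × RA) × (SB × RB)) ((SA × RA) × (SB × RB))))
    (a : ℓ²(RA, ℂ)) (b : ℓ²(RB, ℂ)) (ρ : TraceClass (SA × SB)) : ℝ≥0∞ :=
  sSup (producible E C a b ρ)

end Registers

/-! ### Entanglement measures -/

/-- `E` assigns a number to the states of every bipartite system and does not increase under LOCC
(values at operators that are not states are irrelevant). -/
def IsLOCCMonotone (E : ∀ A B : Type, TraceClass (A × B) → ℝ≥0∞) : Prop :=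
  ∀ (A B A' B' : Type) (Λ : SuperOp (A × B) (A' × B')), IsLOCC Λ →
    ∀ ρ : TraceClass (A × B), IsState ρ → E A' B' (Λ ρ) ≤ E A B ρ

/-- The index set of the `n`-fold tensor power. -/
def TPow (α : Type) : ℕ → Type
  | 0 => Unit
  | n + 1 => TPow α n × α

/-- The `n`-fold tensor power of a bipartite state, Alice's factors first. -/
def tensorPow {α β : Type} (ρ : TraceClass (α × β)) :
    (n : ℕ) → TraceClass (TPow α n × TPow β n)
  | 0 => ⟨(1 : Matrix (Unit × Unit) (Unit × Unit) ℂ),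
      IsPosTC.mem (ι := Unit × Unit) ⟨Matrix.PosSemidef.one, Summable.of_finite⟩⟩
  | n + 1 => tensorBip (tensorPow ρ n) ρ

/-- The fidelity `⟨Φ| σ |Φ⟩` with the maximally entangled state `Φ = d^(-1/2) ∑ᵢ |i⟩|i⟩`. -/
def maxEntFidelity {d : ℕ} (σ : TraceClass (Fin d × Fin d)) : ℝ :=
  ((∑ i, ∑ j, σ.1 (i, i) (j, j)) / d).re

/-- `R` is an achievable rate of distillation: by LOCC, `n` copies of `ρ` are turned into `⌊R n⌋`
ebits, with a fidelity that tends to `1` as `n → ∞`. -/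
def IsDistillationRate {α β : Type} (ρ : TraceClass (α × β)) (R : ℝ) : Prop :=
  ∃ Λ : ∀ n : ℕ, SuperOp (TPow α n × TPow β n) (Fin (2 ^ ⌊R * n⌋₊) × Fin (2 ^ ⌊R * n⌋₊)),
    (∀ n, IsLOCC (Λ n)) ∧
      Filter.Tendsto (fun n => maxEntFidelity (Λ n (tensorPow ρ n))) Filter.atTop (nhds 1)

/-- The entanglement of distillation: the supremum of the achievable rates. -/
def distillableEnt (A B : Type) (ρ : TraceClass (A × B)) : ℝ≥0∞ :=
  ⨆ (R : ℝ) (_ : 0 ≤ R ∧ IsDistillationRate ρ R), ENNReal.ofReal R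

end SSR
end

noncomputable section

namespace SSR

/-! ### Positive semidefinite matrices and infinite sums -/

/-! The superselection rule amounts to twirling the input. If `O` commutes with the local twirl,
then, since tracing out the systems only sees entries diagonal in them, a twirl on the output is
invisible, so `O` yields the same register state from `ρ` as from the twirled `ρ`; and `O` is in
particular LOCC. Conversely, any LOCC `Λ` may be sandwiched between twirls without changing the
register state that it yields from the twirled input. The sandwich is `U(1)`-LOCC even in the
strict, local sense: the number operators of intermediate spaces may be chosen, so the spaces inside
the protocol are declared charge-free, where invariance is vacuous, and the twirls, whose inputs and
outputs do not feel phase shifts, convert between these labels and the true ones. Together with the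
fact that sense (a) implies sense (b), this gives `producible_eq`, hence the first claim for an
arbitrary function `E`.

For an entanglement measure, attaching pure ancillas, applying `Λ` and discarding the systems is a
single LOCC map, which bounds the producible entanglement by that of the twirled state. The bound is
attained because the registers are large enough for each party to move its system into them
reversibly (`exists_move_to_register`, `isGreatest_producible`). Distillable entanglement is a
special case, since `n` copies of an LOCC map form an LOCC map.

Most of the work is analytic, because spaces are infinite-dimensional and instruments have countably
many outcomes. Complete positivity together with trace non-increase yields countable additivity on
positive operators (`IsOperation.hasSum_of_hasSum`), used to compose protocols, and continuity under
finite compressions (`IsOperation.tendsto_compress`), so that identities between operations can be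
checked on matrix units or product operators. -/

theorem hasSum_tsum_comm_of_nonneg {κ ι : Type} {f : κ → ι → ℝ} (h0 : ∀ k i, 0 ≤ f k i)
    {g : ι → ℝ} {t : ℝ} (hg : ∀ i, HasSum (fun k => f k i) (g i)) (ht : HasSum g t) :
    HasSum (fun k => ∑' i, f k i) t := by
  have hs : Summable (fun p : ι × κ => f p.2 p.1) := by
    rw [summable_prod_of_nonneg fun p => h0 _ _]
    refine ⟨fun i => (hg i).summable, ?_⟩
    simpa only [fun i => (hg i).tsum_eq] using ht.summable
  have h1 : HasSum (fun p : ι × κ => f p.2 p.1) t := by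
    have h2 := hs.hasSum
    rwa [(hs.hasSum.prod_fiberwise hg).unique ht] at h2
  have h3 : HasSum (fun p : κ × ι => f p.1 p.2) t :=
    (Equiv.prodComm κ ι).hasSum_iff.mpr h1
  exact h3.prod_fiberwise fun k => (h3.summable.prod_factor k).hasSum

/-- Positivity is tested on finitely supported vectors, and each test sees only a finite corner of
the matrix. -/
theorem posSemidef_of_locally_eq {ι : Type} {M : Matrix ι ι ℂ}
    (h : ∀ S : Finset ι, ∃ M' : Matrix ι ι ℂ, M'.PosSemidef ∧
      ∀ i ∈ S, ∀ j ∈ S, M' i j = M i j) : M.PosSemidef := by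
  classical
  refine ⟨?_, fun x => ?_⟩
  · ext i j
    obtain ⟨M', hM', he⟩ := h {i, j}
    have := hM'.1.apply i j
    rwa [he i (by simp) j (by simp), he j (by simp) i (by simp)] at this
  · obtain ⟨M', hM', he⟩ := h x.support
    refine (hM'.2 x).trans_eq ?_
    exact Finsupp.sum_congr fun i hi => Finsupp.sum_congr fun j hj => by rw [he i hi j hj]

theorem posSemidef_of_hasSum {κ ι : Type} {F : κ → Matrix ι ι ℂ} {M : Matrix ι ι ℂ}
    (hF : ∀ k, (F k).PosSemidef) (h : ∀ i j, HasSum (fun k => F k i j) (M i j)) :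
    M.PosSemidef := by
  refine ⟨?_, fun x => ?_⟩
  · ext i j
    refine (h j i).star.unique ?_
    simpa only [fun k => (hF k).1.apply i j] using h i j
  · have h : HasSum (fun k => x.sum fun i xi => x.sum fun j xj => star xi * F k i j * xj)
        (x.sum fun i xi => x.sum fun j xj => star xi * M i j * xj) :=
      hasSum_sum fun i _ => hasSum_sum fun j _ => ((h i j).mul_left _).mul_right _
    exact h.nonneg fun k => (hF k).2 x

theorem posSemidef_weighted {ι κ : Type} {M : Matrix ι ι ℂ} (hM : M.PosSemidef) (g : κ → ι)
    (w : κ → ℂ) : (Matrix.of fun i j => w i * M (g i) (g j) * star (w j)).PosSemidef := by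
  have h : (Matrix.of fun i j => w i * M (g i) (g j) * star (w j))
      = (M.submatrix g g).hadamard (Matrix.of fun i j => w i * star (w j)) := by
    ext i j
    simp only [Matrix.of_apply, Matrix.hadamard_apply, Matrix.submatrix_apply]
    ring
  rw [h]
  exact (hM.submatrix g).hadamard (posSemidef_rankOne w)

theorem two_mul_norm_le_diag_add_diag {ι : Type} {M : Matrix ι ι ℂ} (hM : M.PosSemidef)
    (i j : ι) : 2 * ‖M i j‖ ≤ (M i i).re + (M j j).re := by
  by_cases h0 : M i j = 0
  · have h1 := (Complex.le_def.mp (hM.diag_nonneg (i := i))).1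
    have h2 := (Complex.le_def.mp (hM.diag_nonneg (i := j))).1
    simp only [h0, norm_zero, mul_zero, Complex.zero_re] at *
    linarith
  · have hn : (‖M i j‖ : ℂ) ≠ 0 := by simpa using h0
    -- Testing `M` on `e_i + c e_j`, with `c` the phase that turns both cross terms into `-‖M i j‖`,
    -- gives the inequality.
    set c : ℂ := -(star (M i j) / ‖M i j‖) with hc
    have h := (posSemidef_combine hM (fun _ : Unit => i) (fun _ => j) c).diag_nonneg (i := ())
    have e1 : c * M i j = -(‖M i j‖ : ℂ) := by
      have : star (M i j) * M i j = (‖M i j‖ : ℂ) ^ 2 := by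
        rw [Complex.star_def, Complex.conj_mul']
      rw [hc]; field_simp; linear_combination -this
    have e2 : star c * M j i = -(‖M i j‖ : ℂ) := by
      have := congrArg star e1
      rw [star_mul', hM.1.apply] at this
      simpa using this
    have e3 : star c * c = 1 := by
      have : star (M i j) * M i j = (‖M i j‖ : ℂ) ^ 2 := by
        rw [Complex.star_def, Complex.conj_mul']
      have hs : star (‖M i j‖ : ℂ) = ‖M i j‖ := Complex.conj_ofReal _
      rw [hc, star_neg, star_div₀, star_star, hs]
      field_simp; linear_combination this
    simp only [Matrix.add_apply, Matrix.submatrix_apply, Matrix.smul_apply, smul_eq_mul, e1, e2,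
      e3] at h
    have := (Complex.le_def.mp h).1
    simp at this
    linarith

/-! ### Trace and positivity -/

/-- Linear statements thus reduce to positive operators, where Tonelli and trace bounds are
available. -/
theorem traceClass_induction {ι : Type} {p : TraceClass ι → Prop}
    (pos : ∀ ρ : TraceClass ι, ρ.1.PosSemidef → p ρ) (add : ∀ ρ σ, p ρ → p σ → p (ρ + σ))
    (smul : ∀ (c : ℂ) ρ, p ρ → p (c • ρ)) (ρ : TraceClass ι) : p ρ := by
  obtain ⟨M, hM⟩ := ρ
  induction hM using Submodule.span_induction with
  | mem M h => exact pos _ h.1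
  | zero => exact pos _ Matrix.PosSemidef.zero
  | add M M' hM hM' h h' => exact add ⟨M, hM⟩ ⟨M', hM'⟩ h h'
  | smul c M hM h => exact smul c ⟨M, hM⟩ h

theorem hasSum_trace {ι : Type} (ρ : TraceClass ι) : HasSum (fun i => ρ.1 i i) (trace ρ) :=
  (summable_diag ρ.2).hasSum

theorem hasSum_trace_re {ι : Type} (ρ : TraceClass ι) :
    HasSum (fun i => (ρ.1 i i).re) (trace ρ).re := Complex.hasSum_re (hasSum_trace ρ)

theorem diag_re_nonneg {ι : Type} {M : Matrix ι ι ℂ} (h : M.PosSemidef) (i : ι) :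
    0 ≤ (M i i).re := (Complex.le_def.mp h.diag_nonneg).1

theorem trace_nonneg {ι : Type} {ρ : TraceClass ι} (h : ρ.1.PosSemidef) : 0 ≤ trace ρ :=
  (hasSum_trace ρ).nonneg fun _ => h.diag_nonneg

theorem trace_re_nonneg {ι : Type} {ρ : TraceClass ι} (h : ρ.1.PosSemidef) : 0 ≤ (trace ρ).re :=
  (Complex.le_def.mp (trace_nonneg h)).1

theorem ofReal_re_of_nonneg {z : ℂ} (h : 0 ≤ z) : (z.re : ℂ) = z :=
  Complex.ext (by simp) (by simpa using (Complex.le_def.mp h).2)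

theorem ofReal_trace_re {ι : Type} {ρ : TraceClass ι} (h : ρ.1.PosSemidef) :
    ((trace ρ).re : ℂ) = trace ρ := ofReal_re_of_nonneg (trace_nonneg h)

/-- Convergence of operators is only ever needed entrywise; this bound deduces it from convergence
of traces. -/
theorem norm_entry_le_trace {ι : Type} {ρ : TraceClass ι} (h : ρ.1.PosSemidef) (i j : ι) :
    ‖ρ.1 i j‖ ≤ (trace ρ).re := by
  have h1 := two_mul_norm_le_diag_add_diag h i j
  have h2 := fun i => le_hasSum (hasSum_trace_re ρ) i fun j _ => diag_re_nonneg h j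
  linarith [h2 i, h2 j]

/-- The trace is countably additive on positive operators. -/
theorem hasSum_trace_of_hasSum {κ ι : Type} {σ : κ → TraceClass ι} {τ : TraceClass ι}
    (hσ : ∀ k, (σ k).1.PosSemidef) (h : ∀ i, HasSum (fun k => (σ k).1 i i) (τ.1 i i)) :
    HasSum (fun k => trace (σ k)) (trace τ) := by
  have hτ : 0 ≤ trace τ := (hasSum_trace τ).nonneg fun i => (h i).nonneg fun k => (hσ k).diag_nonneg
  have h1 := hasSum_tsum_comm_of_nonneg (fun k i => diag_re_nonneg (hσ k) i)
    (fun i => Complex.hasSum_re (h i)) (hasSum_trace_re τ)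
  simp only [fun k => (hasSum_trace_re (σ k)).tsum_eq] at h1
  have h2 := Complex.hasSum_ofReal.mpr h1
  simpa only [fun k => ofReal_trace_re (hσ k), ofReal_re_of_nonneg hτ] using h2

/-! ### Completely positive maps -/

/-- Diagonal blocks of a positive operator are positive. -/
theorem posSemidef_blockA {α γ : Type} {ρ : TraceClass (α × γ)} (h : ρ.1.PosSemidef) (c : γ) :
    (blockA ρ c c).1.PosSemidef := h.submatrix _

theorem blockA_add {α γ : Type} (ρ σ : TraceClass (α × γ)) (c c' : γ) :
    blockA (ρ + σ) c c' = blockA ρ c c' + blockA σ c c' := rfl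

theorem blockA_smul {α γ : Type} (z : ℂ) (ρ : TraceClass (α × γ)) (c c' : γ) :
    blockA (z • ρ) c c' = z • blockA ρ c c' := rfl

theorem hasSum_trace_blockA {α γ : Type} (ρ : TraceClass (α × γ)) :
    HasSum (fun c => trace (blockA ρ c c)) (trace ρ) := by
  have h : HasSum (fun p : γ × α => ρ.1 (p.2, p.1) (p.2, p.1)) (trace ρ) :=
    (Equiv.prodComm γ α).hasSum_iff.mpr (hasSum_trace ρ)
  exact h.prod_fiberwise fun c => hasSum_trace (blockA ρ c c)

/-- Complete positivity also holds with infinite-dimensional spectator systems. -/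
theorem IsCP.posSemidef_blocks {α α' γ : Type} {E : SuperOp α α'} (hE : IsCP E)
    {ρ : TraceClass (α × γ)} (hρ : ρ.1.PosSemidef) :
    (Matrix.of fun x y : α' × γ => (E (blockA ρ x.2 y.2)).1 x.1 y.1).PosSemidef := by
  classical
  refine posSemidef_of_locally_eq fun S => ?_
  rcases S.eq_empty_or_nonempty with rfl | ⟨s, hs⟩
  · exact ⟨0, Matrix.PosSemidef.zero, by simp⟩
  let T := S.image Prod.snd
  have hmem : ∀ x ∈ S, x.2 ∈ T := fun x hx => Finset.mem_image_of_mem _ hx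
  let e := T.equivFin
  let g : Fin T.card → γ := fun i => (e.symm i).1
  have hg : g.Injective := Subtype.val_injective.comp e.symm.injective
  let ρ' : TraceClass (α × Fin T.card) :=
    ⟨ρ.1.submatrix (Prod.map id g) (Prod.map id g),
      submatrix_mem ρ.2 (Function.injective_id.prodMap hg) (Function.injective_id.prodMap hg)⟩
  have h := hE _ ρ' (hρ.submatrix _)
  -- Only the finitely many spectator indices in `T` matter. Outside `T` the value of `q` is
  -- arbitrary, but some element is needed, hence the separate treatment of empty `S`.
  let q : γ → Fin T.card := fun c => if hc : c ∈ T then e ⟨c, hc⟩ else e ⟨s.2, hmem s hs⟩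
  have hq : ∀ c ∈ T, g (q c) = c := fun c hc => by simp [g, q, hc]
  refine ⟨_, h.submatrix (Prod.map id q), fun x hx y hy => ?_⟩
  have e1 : ∀ c ∈ T, ∀ c' ∈ T, blockA ρ' (q c) (q c') = blockA ρ c c' := by
    intro c hc c' hc'
    ext a a'
    simp [blockA, ρ', hq c hc, hq c' hc']
  simp only [Matrix.submatrix_apply, Matrix.of_apply, Prod.map_snd, Prod.map_fst, id]
  rw [e1 _ (hmem x hx) _ (hmem y hy)]

theorem IsCP.posSemidef {α α' : Type} {E : SuperOp α α'} (hE : IsCP E) {ρ : TraceClass α}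
    (hρ : ρ.1.PosSemidef) : (E ρ).1.PosSemidef := by
  let ρ' : TraceClass (α × Unit) := reindex (Equiv.prodPUnit α) ρ
  exact (hE.posSemidef_blocks (ρ := ρ') (hρ.submatrix _)).submatrix fun a => (a, ())

/-- Operations: completely positive maps that do not increase the trace. -/
structure IsOperation {α α' : Type} (E : SuperOp α α') : Prop where
  cp : IsCP E
  trace_le : ∀ ρ : TraceClass α, ρ.1.PosSemidef → (trace (E ρ)).re ≤ (trace ρ).re

/-- Channels: completely positive trace-preserving maps. -/
structure IsChannel {α α' : Type} (E : SuperOp α α') : Prop where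
  cp : IsCP E
  trace_eq : ∀ ρ : TraceClass α, trace (E ρ) = trace ρ

theorem IsChannel.isOperation {α α' : Type} {E : SuperOp α α'} (h : IsChannel E) :
    IsOperation E := ⟨h.cp, fun ρ _ => by rw [h.trace_eq]⟩

theorem IsChannel.isState {α α' : Type} {E : SuperOp α α'} (h : IsChannel E) {ρ : TraceClass α}
    (hρ : IsState ρ) : IsState (E ρ) := ⟨h.cp.posSemidef hρ.1, (h.trace_eq ρ).trans hρ.2⟩

theorem IsInstrument.isOperation {α α' : Type} {E : ℕ → SuperOp α α'} (h : IsInstrument E)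
    (k : ℕ) : IsOperation (E k) :=
  ⟨h.1 k, fun ρ hρ => le_hasSum (Complex.hasSum_re (h.2 ρ)) k fun j _ =>
    trace_re_nonneg ((h.1 j).posSemidef hρ)⟩

/-- The diagonal is summable because the traces of the images of the diagonal blocks are dominated
by the traces of the blocks, which add up to the trace of `ρ`. Trace non-increase is what makes `E ⊗
id` well defined on an infinite spectator. -/
theorem IsOperation.isPosTC_blocks {α α' γ : Type} {E : SuperOp α α'} (hE : IsOperation E)
    {ρ : TraceClass (α × γ)} (hρ : ρ.1.PosSemidef) :
    IsPosTC (Matrix.of fun x y : α' × γ => (E (blockA ρ x.2 y.2)).1 x.1 y.1) := by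
  have hP := hE.cp.posSemidef_blocks hρ
  refine ⟨hP, ?_⟩
  have h1 : Summable fun p : γ × α' => ((E (blockA ρ p.1 p.1)).1 p.2 p.2).re := by
    rw [summable_prod_of_nonneg fun p =>
      diag_re_nonneg (hE.cp.posSemidef (posSemidef_blockA hρ p.1)) p.2]
    refine ⟨fun c => (hasSum_trace_re (E (blockA ρ c c))).summable, ?_⟩
    have h2 : (fun c => ∑' a, ((E (blockA ρ c c)).1 a a).re)
        = fun c => (trace (E (blockA ρ c c))).re :=
      funext fun c => (hasSum_trace_re (E (blockA ρ c c))).tsum_eq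
    rw [h2]
    exact Summable.of_nonneg_of_le
      (fun c => trace_re_nonneg (hE.cp.posSemidef (posSemidef_blockA hρ c)))
      (fun c => hE.trace_le _ (posSemidef_blockA hρ c))
      (Complex.hasSum_re (hasSum_trace_blockA ρ)).summable
  have h2 : Summable fun p : α' × γ => ((E (blockA ρ p.2 p.2)).1 p.1 p.1).re :=
    (Equiv.prodComm α' γ).summable_iff.mpr h1
  refine (Complex.hasSum_ofReal.mpr h2.hasSum).summable.congr fun p => ?_
  exact ofReal_re_of_nonneg (hP.diag_nonneg (i := p))

/-- `E ⊗ id` on `α × γ`. -/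
def extend {α α' : Type} (E : SuperOp α α') (hE : IsOperation E) (γ : Type) :
    SuperOp (α × γ) (α' × γ) where
  toFun ρ := ⟨Matrix.of fun x y => (E (blockA ρ x.2 y.2)).1 x.1 y.1, by
    induction ρ using traceClass_induction with
    | pos ρ hρ => exact (hE.isPosTC_blocks hρ).mem
    | add ρ σ h h' =>
      convert Submodule.add_mem _ h h'
      ext x y
      simp [blockA_add]
    | smul c ρ h =>
      convert Submodule.smul_mem _ c h
      ext x y
      simp [blockA_smul]⟩
  map_add' ρ σ := by
    ext x y
    simp [blockA_add]
  map_smul' c ρ := by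
    ext x y
    simp [blockA_smul]

theorem extend_apply {α α' γ : Type} {E : SuperOp α α'} (hE : IsOperation E)
    (ρ : TraceClass (α × γ)) (x y : α' × γ) :
    (extend E hE γ ρ).1 x y = (E (blockA ρ x.2 y.2)).1 x.1 y.1 := rfl

theorem blockA_extend {α α' γ : Type} {E : SuperOp α α'} (hE : IsOperation E)
    (ρ : TraceClass (α × γ)) (c c' : γ) :
    blockA (extend E hE γ ρ) c c' = E (blockA ρ c c') := rfl

theorem trace_reindex {ι κ : Type} (e : κ ≃ ι) (ρ : TraceClass ι) :
    trace (reindex e ρ) = trace ρ :=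
  Equiv.tsum_eq e fun i => ρ.1 i i

/-- By associativity `(E ⊗ id) ⊗ id` is `E` with one larger spectator, so positivity with arbitrary
spectators applies. -/
theorem isCP_extend {α α' : Type} {E : SuperOp α α'} (hE : IsOperation E) (γ : Type) :
    IsCP (extend E hE γ) := by
  intro n ρ hρ
  let e := Equiv.prodAssoc α γ (Fin n)
  let ρ' : TraceClass (α × (γ × Fin n)) := reindex e.symm ρ
  exact (hE.cp.posSemidef_blocks (ρ := ρ') (hρ.submatrix _)).submatrix
    (Equiv.prodAssoc α' γ (Fin n))

/-- On positive operators, completeness of the outcomes holds in each diagonal block, and Tonelli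
exchanges the sums over blocks and outcomes. -/
theorem isInstrument_extend {α α' : Type} {E : ℕ → SuperOp α α'} (hE : IsInstrument E)
    (γ : Type) : IsInstrument fun k => extend (E k) (hE.isOperation k) γ := by
  refine ⟨fun k => isCP_extend _ _, fun ρ => ?_⟩
  induction ρ using traceClass_induction with
  | pos ρ hρ =>
    have hp := fun k c => (hE.1 k).posSemidef (posSemidef_blockA hρ c)
    have h1 := hasSum_tsum_comm_of_nonneg (fun k c => trace_re_nonneg (hp k c))
      (fun c => Complex.hasSum_re (hE.2 (blockA ρ c c)))
      (Complex.hasSum_re (hasSum_trace_blockA ρ))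
    have h2 : ∀ k, ∑' c, (trace (E k (blockA ρ c c))).re
        = (trace (extend (E k) (hE.isOperation k) γ ρ)).re := fun k =>
      (Complex.hasSum_re (hasSum_trace_blockA (extend (E k) (hE.isOperation k) γ ρ))).tsum_eq
    simp only [h2] at h1
    have h3 := Complex.hasSum_ofReal.mpr h1
    simpa only [fun k => ofReal_trace_re ((isCP_extend (hE.isOperation k) γ).posSemidef hρ),
      ofReal_trace_re hρ] using h3
  | add ρ σ h h' => simpa only [map_add] using h.add h'
  | smul c ρ h => simpa only [map_smul] using h.const_smul c

theorem isInstrument_single {α α' : Type} {E : SuperOp α α'} (hE : IsChannel E) :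
    IsInstrument fun k => if k = 0 then E else 0 := by
  refine ⟨fun k => ?_, fun ρ => ?_⟩
  · by_cases h : k = 0
    · simpa [h] using hE.cp
    · intro n ρ _
      simp only [h, if_false]
      exact Matrix.PosSemidef.zero
  · convert hasSum_single 0 (f := fun k : ℕ => trace ((if k = 0 then E else 0) ρ)) ?_ using 1
    · simp [hE.trace_eq]
    · intro k hk
      simp [hk]

/-- The image under `E ⊗ id` must be trace class before `F ⊗ id` can act on it, so `E` is required
to be an operation and not merely completely positive. -/
theorem IsCP.comp {α β γ : Type} {F : SuperOp β γ} {E : SuperOp α β} (hF : IsCP F)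
    (hE : IsOperation E) : IsCP (F ∘ₗ E) := fun n ρ hρ =>
  hF n (extend E hE (Fin n) ρ) (hE.cp n ρ hρ)

theorem IsOperation.comp {α β γ : Type} {F : SuperOp β γ} {E : SuperOp α β} (hF : IsOperation F)
    (hE : IsOperation E) : IsOperation (F ∘ₗ E) :=
  ⟨hF.cp.comp hE, fun ρ hρ => (hF.trace_le _ (hE.cp.posSemidef hρ)).trans (hE.trace_le ρ hρ)⟩

theorem IsChannel.comp {α β γ : Type} {F : SuperOp β γ} {E : SuperOp α β} (hF : IsChannel F)
    (hE : IsChannel E) : IsChannel (F ∘ₗ E) :=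
  ⟨hF.cp.comp hE.isOperation, fun ρ => (hF.trace_eq _).trans (hE.trace_eq ρ)⟩

/-- A (possibly infinite) sum of maps `ρ ↦ V ρ V†`, where each row of `V` has at most one nonzero
entry, is completely positive. -/
theorem isCP_of_hasSum {α α' κ : Type} {E : SuperOp α α'} (g : κ → α' → α) (w : κ → α' → ℂ)
    (h : ∀ ρ i j, HasSum (fun k => w k i * ρ.1 (g k i) (g k j) * star (w k j)) ((E ρ).1 i j)) :
    IsCP E := fun n ρ hρ =>
  posSemidef_of_hasSum
    (fun k => posSemidef_weighted hρ (fun x : α' × Fin n => (g k x.1, x.2)) fun x => w k x.1)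
    fun x y => h (blockA ρ x.2 y.2) x.1 y.1

theorem isChannel_reindex {ι κ : Type} (e : κ ≃ ι) : IsChannel (reindex e) := by
  refine ⟨isCP_of_hasSum (κ := Unit) (fun _ => e) (fun _ _ => 1) fun ρ i j => ?_, trace_reindex e⟩
  have h := hasSum_unique (fun _ : Unit => ρ.1 (e i) (e j))
  simp only [one_mul, star_one, mul_one]
  exact h

theorem isChannel_id (ι : Type) : IsChannel (LinearMap.id : SuperOp ι ι) :=
  isChannel_reindex (Equiv.refl ι)

theorem isChannel_ptraceFst {α β : Type} : IsChannel (ptraceFst : SuperOp (α × β) β) := by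
  refine ⟨isCP_of_hasSum (κ := α) (fun a b => (a, b)) (fun _ _ => 1) fun ρ i j => ?_, fun ρ => ?_⟩
  · simp only [one_mul, star_one, mul_one]
    exact (summable_ptrace ρ.2 i j).hasSum
  · exact (hasSum_trace (ptraceFst ρ)).unique (hasSum_trace_blockA ρ)

theorem isChannel_twirl {ι : Type} (N : ι → ℕ) : IsChannel (twirl N) := by
  refine ⟨isCP_of_hasSum (κ := ℕ) (fun _ => id) (fun n i => if N i = n then 1 else 0)
    fun ρ i j => ?_, fun ρ => ?_⟩
  · have h : Summable fun n : ℕ =>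
        (if N i = n then 1 else 0) * ρ.1 i j * (if N j = n then (1 : ℂ) else 0) :=
      summable_of_ne_finset_zero (s := {N i}) fun n hn => by
        simp [Ne.symm (Finset.notMem_singleton.mp hn)]
    simpa [twirl] using h.hasSum
  · refine tsum_congr fun i => ?_
    simp [twirl]

/-! ### Continuity of operations -/

theorem IsOperation.norm_entry_le {α α' : Type} {E : SuperOp α α'} (hE : IsOperation E)
    {ρ : TraceClass α} (hρ : ρ.1.PosSemidef) (x y : α') :
    ‖(E ρ).1 x y‖ ≤ (trace ρ).re :=
  (norm_entry_le_trace (hE.cp.posSemidef hρ) x y).trans (hE.trace_le ρ hρ)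

/-- Operations are countably additive on positive operators. -/
theorem IsOperation.hasSum_of_hasSum {κ α α' : Type} {E : SuperOp α α'} (hE : IsOperation E)
    {σ : κ → TraceClass α} {τ : TraceClass α} (hσ : ∀ k, (σ k).1.PosSemidef)
    (h : ∀ i j, HasSum (fun k => (σ k).1 i j) (τ.1 i j)) (x y : α') :
    HasSum (fun k => (E (σ k)).1 x y) ((E τ).1 x y) := by
  have hval : ∀ K : Finset κ, (∑ k ∈ K, σ k).1 = ∑ k ∈ K, (σ k).1 := fun K => by simp
  -- The remainder after a finite partial sum is positive and its trace tends to zero; the trace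
  -- bounds the entries of its image.
  have hrest : ∀ K : Finset κ, (τ - ∑ k ∈ K, σ k).1.PosSemidef := fun K => by
    refine posSemidef_of_hasSum (κ := {k // k ∉ K}) (fun k => hσ k.1) fun i j => ?_
    rw [Finset.hasSum_compl_iff (f := fun k => (σ k).1 i j)]
    simpa [hval, Matrix.sum_apply] using h i j
  have htr : Filter.Tendsto (fun K : Finset κ => (trace (τ - ∑ k ∈ K, σ k)).re) Filter.atTop
      (nhds 0) := by
    have h1 := Complex.hasSum_re (hasSum_trace_of_hasSum hσ fun i => h i i)
    have h2 := (tendsto_const_nhds (x := (trace τ).re)).sub h1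
    simpa [map_sum] using h2
  have hlim := squeeze_zero_norm (fun K => hE.norm_entry_le (hrest K) x y) htr
  have h3 := (tendsto_const_nhds (x := (E τ).1 x y)).sub hlim
  rw [sub_zero] at h3
  refine h3.congr fun K => ?_
  simp [map_sum, Matrix.sum_apply]

/-! ### Normality: operations are determined by their values on matrix units -/

open Classical in
theorem isPosTC_compress {ι : Type} (S : Set ι) {M : Matrix ι ι ℂ} (hM : IsPosTC M) :
    IsPosTC (Matrix.of fun i j => (if i ∈ S then 1 else 0) * M i j * if j ∈ S then 1 else 0) := by
  have h := posSemidef_weighted hM.1 id fun i => if i ∈ S then 1 else 0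
  refine ⟨?_, ?_⟩
  · convert h using 3
    split_ifs <;> simp
  · refine (hM.2.indicator S).congr fun i => ?_
    by_cases hi : i ∈ S <;> simp [hi]

open Classical in
/-- The compression `ρ ↦ P ρ P` by the projector `P` onto the span of the basis vectors in `S`. -/
def compress {ι : Type} (S : Set ι) : SuperOp ι ι where
  toFun ρ := ⟨Matrix.of fun i j => (if i ∈ S then 1 else 0) * ρ.1 i j * if j ∈ S then 1 else 0, by
    let F : Matrix ι ι ℂ →ₗ[ℂ] Matrix ι ι ℂ :=
      { toFun := fun M => Matrix.of fun i j =>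
          (if i ∈ S then 1 else 0) * M i j * if j ∈ S then 1 else 0
        map_add' := fun M M' => by
          ext i j
          simp only [Matrix.of_apply, Matrix.add_apply]
          ring
        map_smul' := fun c M => by
          ext i j
          simp only [Matrix.of_apply, Matrix.smul_apply, smul_eq_mul, RingHom.id_apply]
          ring }
    exact map_mem F (fun M hM => (isPosTC_compress S hM).mem) ρ.2⟩
  map_add' ρ σ := by
    ext i j
    simp only [Matrix.of_apply, Submodule.coe_add, Matrix.add_apply]
    ring
  map_smul' c ρ := by
    ext i j
    simp only [Matrix.of_apply, SetLike.val_smul, Matrix.smul_apply, smul_eq_mul, RingHom.id_apply]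
    ring

open Classical in
theorem compress_apply {ι : Type} (S : Set ι) (ρ : TraceClass ι) (i j : ι) :
    (compress S ρ).1 i j = (if i ∈ S then 1 else 0) * ρ.1 i j * if j ∈ S then 1 else 0 := rfl

theorem posSemidef_compress {ι : Type} (S : Set ι) {ρ : TraceClass ι} (h : ρ.1.PosSemidef) :
    (compress S ρ).1.PosSemidef := (isPosTC_compress S ⟨h, summable_diag ρ.2⟩).1

theorem trace_compress {ι : Type} (S : Finset ι) (ρ : TraceClass ι) :
    trace (compress (S : Set ι) ρ) = ∑ i ∈ S, ρ.1 i i := by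
  refine (hasSum_trace (compress (S : Set ι) ρ)).unique ?_
  have h := hasSum_sum_of_ne_finset_zero (f := fun i => (compress (S : Set ι) ρ).1 i i) (s := S)
    (L := .unconditional ι) fun i hi => by simp [compress_apply, hi]
  convert h using 1
  exact Finset.sum_congr rfl fun i hi => by simp [compress_apply, hi]

theorem trace_compress_add_compl {ι : Type} (S : Set ι) (ρ : TraceClass ι) :
    trace (compress S ρ) + trace (compress Sᶜ ρ) = trace ρ := by
  refine ((hasSum_trace (compress S ρ)).add (hasSum_trace (compress Sᶜ ρ))).unique ?_
  convert hasSum_trace ρ using 2 with i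
  by_cases hi : i ∈ S <;> simp [compress_apply, hi]

/-- With `P` the projector onto `S` and `Q = 1 - P`, this is `(tP + sQ) ρ (tP + sQ)`: the coherences
`PρQ + QρP` acquire the weight `ts`. -/
theorem posSemidef_weighted_blocks {ι : Type} (S : Set ι) {ρ : TraceClass ι}
    (hρ : ρ.1.PosSemidef) (t s : ℝ) :
    ((t ^ 2 : ℂ) • compress S ρ + (s ^ 2 : ℂ) • compress Sᶜ ρ
      + (t * s : ℂ) • (ρ - compress S ρ - compress Sᶜ ρ)).1.PosSemidef := by
  classical
  have h := posSemidef_weighted hρ id fun i => if i ∈ S then (t : ℂ) else s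
  convert h using 1
  ext i j
  by_cases hi : i ∈ S <;> by_cases hj : j ∈ S <;> simp [compress_apply, hi, hj] <;> ring

/-- The coherences between `S` and its complement are half the difference of the positive operators
weighted by `(t, t⁻¹)` and `(t, -t⁻¹)`. Their images are bounded by the traces, to which the
coherences do not contribute. A small `t` suppresses the large block, at the price of the factor
`t⁻²` on the small one. -/
theorem IsOperation.norm_sub_compress_le {α α' : Type} {E : SuperOp α α'} (hE : IsOperation E)
    {ρ : TraceClass α} (hρ : ρ.1.PosSemidef) (S : Set α) {t : ℝ} (ht : 0 < t) (x y : α') :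
    ‖(E (compress S ρ)).1 x y - (E ρ).1 x y‖
      ≤ t ^ 2 * (trace ρ).re + ((t⁻¹) ^ 2 + 1) * (trace (compress Sᶜ ρ)).re := by
  set A := compress S ρ with hA
  set B := compress Sᶜ ρ with hB
  have hAp := posSemidef_compress S hρ
  have hBp := posSemidef_compress Sᶜ hρ
  have h1 := hE.norm_entry_le (posSemidef_weighted_blocks S hρ t t⁻¹) x y
  have h2 := hE.norm_entry_le (posSemidef_weighted_blocks S hρ t (-t⁻¹)) x y
  have h3 := hE.norm_entry_le hBp x y
  have ht' : (t : ℂ) ≠ 0 := by exact_mod_cast ht.ne'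
  set X₁ := (t ^ 2 : ℂ) • A + ((t⁻¹ : ℝ) ^ 2 : ℂ) • B + (t * (t⁻¹ : ℝ) : ℂ) • (ρ - A - B) with hX₁
  set X₂ := (t ^ 2 : ℂ) • A + ((-t⁻¹ : ℝ) ^ 2 : ℂ) • B + (t * (-t⁻¹ : ℝ) : ℂ) • (ρ - A - B) with hX₂
  have e1 : ρ - A = (1 / 2 : ℂ) • (X₁ - X₂) + B := by
    rw [hX₁, hX₂]
    push_cast
    rw [mul_neg, mul_inv_cancel₀ ht', neg_sq]
    module
  have e2 : trace X₁ + trace X₂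
      = ((2 * (t ^ 2 * (trace A).re + (t⁻¹) ^ 2 * (trace B).re) : ℝ) : ℂ) := by
    have : X₁ + X₂ = ((2 * t ^ 2 : ℝ) : ℂ) • A + ((2 * (t⁻¹) ^ 2 : ℝ) : ℂ) • B := by
      rw [hX₁, hX₂]
      push_cast
      rw [mul_neg, mul_inv_cancel₀ ht', neg_sq]
      module
    rw [← map_add, this, map_add, map_smul, map_smul, ← ofReal_trace_re hAp,
      ← ofReal_trace_re hBp]
    simp only [smul_eq_mul]
    push_cast
    simp only [Complex.ofReal_re]
    ring
  have e3 : (trace A).re ≤ (trace ρ).re := by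
    have h4 := congrArg Complex.re (trace_compress_add_compl S ρ)
    have h5 := trace_re_nonneg hBp
    rw [Complex.add_re] at h4
    linarith
  have e4 : (trace X₁).re + (trace X₂).re
      = 2 * (t ^ 2 * (trace A).re + (t⁻¹) ^ 2 * (trace B).re) := by
    rw [← Complex.add_re, e2, Complex.ofReal_re]
  have e5 : (E A).1 x y - (E ρ).1 x y
      = -((1 / 2 : ℂ) * ((E X₁).1 x y - (E X₂).1 x y) + (E B).1 x y) := by
    have := congrArg (fun σ => (E σ).1 x y) e1
    simp only [map_sub, map_add, map_smul, Submodule.coe_sub, Submodule.coe_add,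
      SetLike.val_smul, Matrix.sub_apply, Matrix.add_apply, Matrix.smul_apply, smul_eq_mul] at this
    linear_combination -this
  rw [e5, norm_neg]
  have e6 : ‖(1 / 2 : ℂ) * ((E X₁).1 x y - (E X₂).1 x y)‖
      ≤ 1 / 2 * (‖(E X₁).1 x y‖ + ‖(E X₂).1 x y‖) := by
    rw [norm_mul]
    simpa using norm_sub_le ((E X₁).1 x y) ((E X₂).1 x y)
  refine (norm_add_le _ _).trans ?_
  nlinarith [sq_nonneg t]

theorem IsOperation.tendsto_compress {α α' : Type} {E : SuperOp α α'} (hE : IsOperation E)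
    (ρ : TraceClass α) (x y : α') :
    Filter.Tendsto (fun S : Finset α => (E (compress (S : Set α) ρ)).1 x y) Filter.atTop
      (nhds ((E ρ).1 x y)) := by
  induction ρ using traceClass_induction with
  | pos ρ hρ =>
    have h0 : Filter.Tendsto (fun S : Finset α => (trace (compress (S : Set α)ᶜ ρ)).re)
        Filter.atTop (nhds 0) := by
      have h1 := (tendsto_const_nhds (x := (trace ρ).re)).sub (hasSum_trace_re ρ)
      rw [sub_self] at h1
      refine h1.congr fun S => ?_
      rw [← trace_compress_add_compl (S : Set α), trace_compress, Complex.add_re, Complex.re_sum]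
      ring
    rw [Metric.tendsto_nhds]
    intro ε hε
    -- `t` is fixed first, to make the term independent of `S` smaller than `ε`; then the trace
    -- outside `S` goes to zero. The `+ 1` below avoids dividing by a zero trace.
    obtain ⟨t, ht, htε⟩ : ∃ t : ℝ, 0 < t ∧ t ^ 2 * (trace ρ).re < ε := by
      have hT := trace_re_nonneg hρ
      refine ⟨√(ε / ((trace ρ).re + 1)), Real.sqrt_pos.mpr (by positivity), ?_⟩
      rw [Real.sq_sqrt (by positivity), div_mul_eq_mul_div, div_lt_iff₀ (by positivity)]
      nlinarith
    have h2 := (h0.const_mul ((t⁻¹) ^ 2 + 1)).const_add (t ^ 2 * (trace ρ).re)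
    rw [mul_zero, add_zero] at h2
    filter_upwards [h2.eventually_lt_const htε] with S hS
    rw [dist_eq_norm]
    exact (hE.norm_sub_compress_le hρ S ht x y).trans_lt hS
  | add ρ σ h h' => simpa using h.add h'
  | smul c ρ h => simpa using h.const_mul c

open Classical in
/-- The matrix unit `|i⟩⟨j|`. -/
def matrixUnit {ι : Type} (i j : ι) : TraceClass ι :=
  ⟨Matrix.single i j 1, by
    have h : Matrix.single i i (1 : ℂ) ∈ TraceClass ι := by
      refine IsPosTC.mem ⟨?_, ?_⟩
      · rw [← Matrix.diagonal_single]
        exact Matrix.PosSemidef.diagonal (Pi.single_nonneg.mpr zero_le_one)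
      · refine summable_of_ne_finset_zero (s := {i}) fun k hk => ?_
        simp [Ne.symm (Finset.notMem_singleton.mp hk)]
    -- Permuting the columns of `|i⟩⟨i|` by the transposition of `i` and `j` gives `|i⟩⟨j|`.
    convert submatrix_mem h Function.injective_id (Equiv.swap i j).injective using 1
    ext x y
    simp only [Matrix.single_apply, Matrix.submatrix_apply, id]
    congr 2
    rw [eq_comm (a := i), Equiv.swap_apply_eq_iff, Equiv.swap_apply_left, eq_comm (a := y)]⟩

open Classical in
theorem matrixUnit_apply {ι : Type} (i j x y : ι) :
    (matrixUnit i j).1 x y = if i = x ∧ j = y then 1 else 0 := Matrix.single_apply ..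

theorem compress_eq_sum {ι : Type} (S : Finset ι) (ρ : TraceClass ι) :
    compress (S : Set ι) ρ = ∑ i ∈ S, ∑ j ∈ S, ρ.1 i j • matrixUnit i j := by
  classical
  ext x y
  simp only [AddSubmonoidClass.coe_finsetSum, SetLike.val_smul, Matrix.sum_apply,
    Matrix.smul_apply, matrixUnit_apply, smul_eq_mul, mul_ite, mul_one, mul_zero, ite_and,
    compress_apply, Finset.mem_coe]
  by_cases hx : x ∈ S <;> by_cases hy : y ∈ S <;> simp [hx, hy]

/-- Finite compressions are finite combinations of matrix units, and operations are continuous along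
them. This fails for general linear maps on trace-class operators. -/
theorem IsOperation.ext_matrixUnit {α α' : Type} {E F : SuperOp α α'} (hE : IsOperation E)
    (hF : IsOperation F) (h : ∀ i j, E (matrixUnit i j) = F (matrixUnit i j)) : E = F := by
  ext ρ x y
  refine tendsto_nhds_unique (hE.tendsto_compress ρ x y) ((hF.tendsto_compress ρ x y).congr ?_)
  intro S
  simp only [compress_eq_sum, map_sum, map_smul, h]

theorem matrixUnit_prod {α β : Type} (i j : α × β) :
    matrixUnit i j = tensor (matrixUnit i.1 j.1) (matrixUnit i.2 j.2) := by
  ext x y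
  obtain ⟨i₁, i₂⟩ := i
  obtain ⟨j₁, j₂⟩ := j
  obtain ⟨x₁, x₂⟩ := x
  obtain ⟨y₁, y₂⟩ := y
  simp only [tensor, Matrix.kronecker, Matrix.kroneckerMap_apply, matrixUnit_apply, Prod.mk.injEq]
  split_ifs <;> simp_all

/-- Operations on a composite system are determined by their values on product operators. -/
theorem IsOperation.ext_tensor {α β γ : Type} {E F : SuperOp (α × β) γ} (hE : IsOperation E)
    (hF : IsOperation F) (h : ∀ μ ν, E (tensor μ ν) = F (tensor μ ν)) : E = F :=
  hE.ext_matrixUnit hF fun i j => by rw [matrixUnit_prod, h]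

/-! ### Invariant operations commute with the twirl -/

theorem twirl_entry {ι : Type} (N : ι → ℕ) (ρ : TraceClass ι) (i j : ι) :
    (twirl N ρ).1 i j = if N i = N j then ρ.1 i j else 0 := twirl_apply N ρ.1 i j

theorem phase_entry {ι : Type} (N : ι → ℕ) (φ : ℝ) (ρ : TraceClass ι) (i j : ι) :
    (phase N φ ρ).1 i j = Complex.exp (Complex.I * φ * ((N i : ℂ) - N j)) * ρ.1 i j := by
  have h : star (Complex.exp (Complex.I * φ * N j)) = Complex.exp (-(Complex.I * φ * N j)) := by
    rw [Complex.star_def, ← Complex.exp_conj]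
    simp
  simp only [phase, LinearMap.coe_mk, AddHom.coe_mk, Matrix.of_apply, h]
  rw [mul_sub, sub_eq_add_neg, Complex.exp_add]
  ring

theorem phase_matrixUnit {ι : Type} (N : ι → ℕ) (φ : ℝ) (i j : ι) :
    phase N φ (matrixUnit i j)
      = Complex.exp (Complex.I * φ * ((N i : ℂ) - N j)) • matrixUnit i j := by
  ext x y
  simp only [phase_entry, SetLike.val_smul, Matrix.smul_apply, smul_eq_mul, matrixUnit_apply]
  split_ifs with h
  · rw [h.1, h.2]
  · simp

theorem twirl_matrixUnit {ι : Type} (N : ι → ℕ) (i j : ι) :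
    twirl N (matrixUnit i j) = if N i = N j then matrixUnit i j else 0 := by
  ext x y
  rw [twirl_entry]
  by_cases h : i = x ∧ j = y
  · obtain ⟨rfl, rfl⟩ := h
    split_ifs <;> simp
  · split_ifs <;> simp [matrixUnit_apply, h]

/-- A phase shift multiplies `|i⟩⟨j|` by a character of the charge difference `N i - N j`, so a
covariant map can only produce entries with the same difference. -/
theorem IsU1Invariant.entry_matrixUnit_eq_zero {α α' : Type} {N : α → ℕ} {N' : α' → ℕ}
    {E : SuperOp α α'} (hU : IsU1Invariant N N' E) {i j : α} {x y : α'}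
    (h : (N' x : ℤ) - N' y ≠ N i - N j) : (E (matrixUnit i j)).1 x y = 0 := by
  set d : ℤ := (N' x : ℤ) - N' y - (N i - N j) with hd
  have hd0 : d ≠ 0 := sub_ne_zero.mpr h
  have hdc : (d : ℂ) ≠ 0 := by exact_mod_cast hd0
  -- With `d` the mismatch of the charge differences, the angle `π / d` makes the two phase factors
  -- opposite, so the entry equals its own negative.
  have h1 := congrArg (fun σ => σ.1 x y) (LinearMap.congr_fun (hU (Real.pi / d)) (matrixUnit i j))
  simp only [LinearMap.comp_apply, phase_matrixUnit, map_smul, SetLike.val_smul,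
    Matrix.smul_apply, smul_eq_mul, phase_entry] at h1
  have h2 : Complex.exp (Complex.I * (Real.pi / d : ℝ) * ((N' x : ℂ) - N' y))
      = -Complex.exp (Complex.I * (Real.pi / d : ℝ) * ((N i : ℂ) - N j)) := by
    have e : Complex.I * (Real.pi / d : ℝ) * ((N' x : ℂ) - N' y)
        = Complex.I * (Real.pi / d : ℝ) * ((N i : ℂ) - N j) + Real.pi * Complex.I := by
      have : (d : ℂ) = (N' x : ℂ) - N' y - (N i - N j) := by rw [hd]; push_cast; ring
      push_cast
      field_simp
      rw [this]
      ring
    rw [e, Complex.exp_add, Complex.exp_pi_mul_I]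
    ring
  rw [h2] at h1
  have h3 : 2 * Complex.exp (Complex.I * (Real.pi / d : ℝ) * ((N i : ℂ) - N j))
      * (E (matrixUnit i j)).1 x y = 0 := by linear_combination h1
  simpa [Complex.exp_ne_zero] using h3

/-- The twirl keeps the entries of charge difference zero and kills all others; an invariant map
preserves that difference. Checking this on matrix units avoids averaging over `φ`. -/
theorem IsU1Invariant.comp_twirl {α α' : Type} {N : α → ℕ} {N' : α' → ℕ} {E : SuperOp α α'}
    (hU : IsU1Invariant N N' E) (hE : IsOperation E) : E ∘ₗ twirl N = twirl N' ∘ₗ E := by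
  refine (hE.comp (isChannel_twirl N).isOperation).ext_matrixUnit
    ((isChannel_twirl N').isOperation.comp hE) fun i j => ?_
  ext x y
  simp only [LinearMap.comp_apply, twirl_matrixUnit, twirl_entry]
  by_cases h1 : N i = N j <;> by_cases h2 : N' x = N' y
  · simp [h1, h2]
  · simp only [h1, h2, if_true, if_false]
    exact hU.entry_matrixUnit_eq_zero (by omega)
  · simp only [h1, h2, if_true, if_false, map_zero]
    exact (hU.entry_matrixUnit_eq_zero (by omega)).symm
  · simp [h1, h2]

theorem twirl_comp_phase {ι : Type} (N : ι → ℕ) (φ : ℝ) : twirl N ∘ₗ phase N φ = twirl N := by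
  ext ρ i j
  simp only [LinearMap.comp_apply, twirl_entry, phase_entry]
  split_ifs with h <;> simp [h]

theorem phase_comp_twirl {ι : Type} (N : ι → ℕ) (φ : ℝ) : phase N φ ∘ₗ twirl N = twirl N := by
  ext ρ i j
  simp only [LinearMap.comp_apply, twirl_entry, phase_entry]
  split_ifs with h <;> simp [h]

theorem phase_zero {ι : Type} (φ : ℝ) : phase (fun _ : ι => 0) φ = LinearMap.id := by
  ext ρ i j
  simp [phase_entry]

theorem isU1Invariant_zero {α α' : Type} (E : SuperOp α α') :
    IsU1Invariant (fun _ => 0) (fun _ => 0) E := fun φ => by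
  rw [phase_zero, phase_zero, LinearMap.comp_id, LinearMap.id_comp]

/-! ### Operations on one side of a bipartite system -/

/-- `id ⊗ E` on `α × β`. -/
def extendB {β β' : Type} (E : SuperOp β β') (hE : IsOperation E) (α : Type) :
    SuperOp (α × β) (α × β') :=
  reindex (Equiv.prodComm α β') ∘ₗ extend E hE α ∘ₗ reindex (Equiv.prodComm β α)

theorem extendB_apply {α β β' : Type} {E : SuperOp β β'} (hE : IsOperation E)
    (ρ : TraceClass (α × β)) (x y : α × β') :
    (extendB E hE α ρ).1 x y = (E (blockB ρ x.1 y.1)).1 x.2 y.2 := rfl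

theorem actsOnA_extend {α α' : Type} {E : SuperOp α α'} (hE : IsOperation E) (β : Type) :
    ActsOnA E (extend E hE β) := fun _ _ _ => rfl

theorem actsOnB_extendB {β β' : Type} {E : SuperOp β β'} (hE : IsOperation E) (α : Type) :
    ActsOnB E (extendB E hE α) := fun _ _ _ => rfl

theorem ActsOnA.eq_extend {α α' β : Type} {E : SuperOp α α'} {F : SuperOp (α × β) (α' × β)}
    (h : ActsOnA E F) (hE : IsOperation E) : F = extend E hE β := by
  ext ρ x y
  exact h ρ x y

theorem ActsOnB.eq_extendB {α β β' : Type} {E : SuperOp β β'} {F : SuperOp (α × β) (α × β')}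
    (h : ActsOnB E F) (hE : IsOperation E) : F = extendB E hE α := by
  ext ρ x y
  exact h ρ x y

theorem IsInstrument.conj {α α' β β' : Type} {E : ℕ → SuperOp α α'} (hE : IsInstrument E)
    {F : SuperOp α' β'} (hF : IsChannel F) {G : SuperOp β α} (hG : IsChannel G) :
    IsInstrument fun k => F ∘ₗ E k ∘ₗ G := by
  refine ⟨fun k => hF.cp.comp ((hE.isOperation k).comp hG.isOperation), fun ρ => ?_⟩
  simpa only [LinearMap.comp_apply, hF.trace_eq, hG.trace_eq] using hE.2 (G ρ)

theorem IsInstrument.of_actsOnA {α α' β : Type} {E : ℕ → SuperOp α α'}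
    {F : ℕ → SuperOp (α × β) (α' × β)} (hE : IsInstrument E) (h : ∀ k, ActsOnA (E k) (F k)) :
    IsInstrument F := by
  have : F = fun k => extend (E k) (hE.isOperation k) β :=
    funext fun k => (h k).eq_extend (hE.isOperation k)
  rw [this]
  exact isInstrument_extend hE β

theorem IsInstrument.of_actsOnB {α β β' : Type} {E : ℕ → SuperOp β β'}
    {F : ℕ → SuperOp (α × β) (α × β')} (hE : IsInstrument E) (h : ∀ k, ActsOnB (E k) (F k)) :
    IsInstrument F := by
  have : F = fun k => extendB (E k) (hE.isOperation k) α :=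
    funext fun k => (h k).eq_extendB (hE.isOperation k)
  rw [this]
  exact (isInstrument_extend hE α).conj (isChannel_reindex _) (isChannel_reindex _)

theorem extend_tensor {α α' β : Type} {E : SuperOp α α'} (hE : IsOperation E)
    (μ : TraceClass α) (ν : TraceClass β) : extend E hE β (tensor μ ν) = tensor (E μ) ν := by
  ext x y
  have h : blockA (tensor μ ν) x.2 y.2 = ν.1 x.2 y.2 • μ := by
    ext a a'
    simp [blockA, tensor, mul_comm]
  rw [extend_apply, h, map_smul]
  simp [tensor, mul_comm]

theorem extendB_tensor {α β β' : Type} {E : SuperOp β β'} (hE : IsOperation E)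
    (μ : TraceClass α) (ν : TraceClass β) : extendB E hE α (tensor μ ν) = tensor μ (E ν) := by
  ext x y
  have h : blockB (tensor μ ν) x.1 y.1 = μ.1 x.1 y.1 • ν := by
    ext a a'
    simp [blockB, tensor]
  rw [extendB_apply, h, map_smul]
  simp [tensor]

/-! ### LOCC operations -/

/-- An instrument followed by a channel that depends on the outcome is a channel. -/
theorem IsSumOf.isChannel {α β γ : Type} {E : ℕ → SuperOp α β} {F : ℕ → SuperOp β γ}
    {G : SuperOp α γ} (hG : IsSumOf (fun k => F k ∘ₗ E k) G) (hE : IsInstrument E)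
    (hF : ∀ k, IsChannel (F k)) : IsChannel G := by
  have hFE := fun k => (hF k).cp.comp (hE.isOperation k)
  refine ⟨fun n ρ hρ => ?_, fun ρ => ?_⟩
  · exact posSemidef_of_hasSum (fun k => hFE k n ρ hρ) fun x y => hG _ _ _
  · induction ρ using traceClass_induction with
    | pos ρ hρ =>
      have h := hasSum_trace_of_hasSum (fun k => (hFE k).posSemidef hρ) fun i => hG ρ i i
      simp only [LinearMap.comp_apply, fun k => (hF k).trace_eq] at h
      exact h.unique (hE.2 ρ)
    | add ρ σ h h' => simp only [map_add, h, h']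
    | smul c ρ h => simp only [map_smul, h]

/-- Pulling `T` through a countable sum over outcomes uses countable additivity on positive
operators; entrywise convergence alone would not allow it for a linear map. -/
theorem IsSumOf.comp_left {α β γ δ : Type} {E : ℕ → SuperOp α β} {F : ℕ → SuperOp β γ}
    {G : SuperOp α γ} (hG : IsSumOf (fun k => F k ∘ₗ E k) G) (hE : IsInstrument E)
    (hF : ∀ k, IsChannel (F k)) {T : SuperOp γ δ} (hT : IsOperation T) :
    IsSumOf (fun k => (T ∘ₗ F k) ∘ₗ E k) (T ∘ₗ G) := by
  intro ρ
  induction ρ using traceClass_induction with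
  | pos ρ hρ =>
    exact hT.hasSum_of_hasSum
      (fun k => ((hF k).cp.comp (hE.isOperation k)).posSemidef hρ) (hG ρ)
  | add ρ σ h h' =>
    intro x y
    simpa using (h x y).add (h' x y)
  | smul c ρ h =>
    intro x y
    simpa using (h x y).mul_left c

theorem LOCCRounds.isChannel {α' β' : Type} {r : ℕ} {α β : Type}
    {G : SuperOp (α × β) (α' × β')} (h : LOCCRounds α' β' r α β G) : IsChannel G := by
  induction h with
  | done r => exact isChannel_id _
  | alice E Ê F G hE hÊ hF hG ih => exact hG.isChannel (hE.of_actsOnA hÊ) ih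
  | bob E Ê F G hE hÊ hF hG ih => exact hG.isChannel (hE.of_actsOnB hÊ) ih

theorem IsLOCC.isChannel {α β α' β' : Type} {G : SuperOp (α × β) (α' × β')} (h : IsLOCC G) :
    IsChannel G := h.elim fun _ h => h.isChannel

theorem LOCCRounds.mono {α' β' : Type} {r : ℕ} {α β : Type} {G : SuperOp (α × β) (α' × β')}
    (h : LOCCRounds α' β' r α β G) : ∀ {s : ℕ}, r ≤ s → LOCCRounds α' β' s α β G := by
  induction h with
  | done r => exact fun {s} _ => .done s
  | alice E Ê F G hE hÊ hF hG ih =>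
    rintro (_ | s) hs
    · omega
    · exact .alice E Ê F G hE hÊ (fun k => ih k (by omega)) hG
  | bob E Ê F G hE hÊ hF hG ih =>
    rintro (_ | s) hs
    · omega
    · exact .bob E Ê F G hE hÊ (fun k => ih k (by omega)) hG

/-- The protocol for `T` is appended to every branch of the protocol for `G`. -/
theorem LOCCRounds.comp {α' β' α'' β'' : Type} {r s : ℕ} {α β : Type}
    {G : SuperOp (α × β) (α' × β')} {T : SuperOp (α' × β') (α'' × β'')}
    (hT : LOCCRounds α'' β'' s α' β' T) (h : LOCCRounds α' β' r α β G) :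
    LOCCRounds α'' β'' (s + r) α β (T ∘ₗ G) := by
  induction h with
  | done r => exact hT.mono (Nat.le_add_right s r)
  | alice E Ê F G hE hÊ hF hG ih =>
    exact .alice E Ê (fun k => T ∘ₗ F k) (T ∘ₗ G) hE hÊ ih
      (hG.comp_left (hE.of_actsOnA hÊ) (fun k => (hF k).isChannel) hT.isChannel.isOperation)
  | bob E Ê F G hE hÊ hF hG ih =>
    exact .bob E Ê (fun k => T ∘ₗ F k) (T ∘ₗ G) hE hÊ ih
      (hG.comp_left (hE.of_actsOnB hÊ) (fun k => (hF k).isChannel) hT.isChannel.isOperation)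

theorem IsLOCC.comp {α β α' β' α'' β'' : Type} {G : SuperOp (α × β) (α' × β')}
    {T : SuperOp (α' × β') (α'' × β'')} (hT : IsLOCC T) (hG : IsLOCC G) : IsLOCC (T ∘ₗ G) := by
  obtain ⟨s, hT⟩ := hT
  obtain ⟨r, hG⟩ := hG
  exact ⟨s + r, hT.comp hG⟩

theorem isLOCC_id (α β : Type) : IsLOCC (LinearMap.id : SuperOp (α × β) (α × β)) := ⟨0, .done 0⟩

theorem isSumOf_single {α β γ : Type} (F : SuperOp β γ) (E : SuperOp α β) :
    IsSumOf (fun k => F ∘ₗ if k = 0 then E else 0) (F ∘ₗ E) := by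
  intro ρ x y
  exact hasSum_single 0 (f := fun k : ℕ => ((F ∘ₗ if k = 0 then E else 0) ρ).1 x y)
    fun k hk => by simp [hk]

theorem ActsOnA.single {α α' β : Type} {E : SuperOp α α'} {F : SuperOp (α × β) (α' × β)}
    (h : ActsOnA E F) (k : ℕ) : ActsOnA (if k = 0 then E else 0) (if k = 0 then F else 0) := by
  split_ifs
  · exact h
  · exact fun _ _ _ => rfl

theorem ActsOnB.single {α β β' : Type} {E : SuperOp β β'} {F : SuperOp (α × β) (α × β')}
    (h : ActsOnB E F) (k : ℕ) : ActsOnB (if k = 0 then E else 0) (if k = 0 then F else 0) := by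
  split_ifs
  · exact h
  · exact fun _ _ _ => rfl

theorem ActsOnA.isLOCC {α α' β : Type} {E : SuperOp α α'} {F : SuperOp (α × β) (α' × β)}
    (h : ActsOnA E F) (hE : IsChannel E) : IsLOCC F :=
  ⟨1, .alice _ _ (fun _ => LinearMap.id) F (isInstrument_single hE) h.single
    (fun _ => .done 0) (isSumOf_single LinearMap.id F)⟩

theorem ActsOnB.isLOCC {α β β' : Type} {E : SuperOp β β'} {F : SuperOp (α × β) (α × β')}
    (h : ActsOnB E F) (hE : IsChannel E) : IsLOCC F :=
  ⟨1, .bob _ _ (fun _ => LinearMap.id) F (isInstrument_single hE) h.single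
    (fun _ => .done 0) (isSumOf_single LinearMap.id F)⟩

/-- The product `E ⊗ F` of two channels. -/
def localMap {α α' β β' : Type} {E : SuperOp α α'} {F : SuperOp β β'} (hE : IsChannel E)
    (hF : IsChannel F) : SuperOp (α × β) (α' × β') :=
  extendB F hF.isOperation α' ∘ₗ extend E hE.isOperation β

theorem isLOCC_localMap {α α' β β' : Type} {E : SuperOp α α'} {F : SuperOp β β'}
    (hE : IsChannel E) (hF : IsChannel F) : IsLOCC (localMap hE hF) :=
  ((actsOnB_extendB hF.isOperation α').isLOCC hF).comp
    ((actsOnA_extend hE.isOperation β).isLOCC hE)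

theorem localMap_tensor {α α' β β' : Type} {E : SuperOp α α'} {F : SuperOp β β'}
    (hE : IsChannel E) (hF : IsChannel F) (μ : TraceClass α) (ν : TraceClass β) :
    localMap hE hF (tensor μ ν) = tensor (E μ) (F ν) := by
  simp only [localMap, LinearMap.comp_apply, extend_tensor, extendB_tensor]

/-- A channel that acts on product operators as `E ⊗ F` is `E ⊗ F`. -/
theorem IsChannel.eq_localMap {α α' β β' : Type} {E : SuperOp α α'} {F : SuperOp β β'}
    {G : SuperOp (α × β) (α' × β')} (hG : IsChannel G) (hE : IsChannel E) (hF : IsChannel F)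
    (h : ∀ μ ν, G (tensor μ ν) = tensor (E μ) (F ν)) : G = localMap hE hF :=
  hG.isOperation.ext_tensor (isLOCC_localMap hE hF).isChannel.isOperation fun μ ν => by
    rw [h, localMap_tensor]

/-! ### Spectator systems -/

/-- `G ⊗ id`, regrouped so that Alice's two factors come first. -/
def withSpectators {α β α' β' : Type} (G : SuperOp (α × β) (α' × β')) (hG : IsOperation G)
    (γ δ : Type) : SuperOp ((α × γ) × (β × δ)) ((α' × γ) × (β' × δ)) :=
  reindex (Equiv.prodProdProdComm α' γ β' δ) ∘ₗ extend G hG (γ × δ) ∘ₗ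
    reindex (Equiv.prodProdProdComm α γ β δ).symm

theorem withSpectators_tensorBip {α β α' β' γ δ : Type} {G : SuperOp (α × β) (α' × β')}
    (hG : IsOperation G) (ρ : TraceClass (α × β)) (σ : TraceClass (γ × δ)) :
    withSpectators G hG γ δ (tensorBip ρ σ) = tensorBip (G ρ) σ := by
  have h : reindex (Equiv.prodProdProdComm α γ β δ).symm (tensorBip ρ σ) = tensor ρ σ := rfl
  simp only [withSpectators, LinearMap.comp_apply, h, extend_tensor]
  rfl

theorem isSumOf_withSpectators {α β α₁ β₁ α' β' γ δ : Type}
    {E : ℕ → SuperOp (α × β) (α₁ × β₁)} {F : ℕ → SuperOp (α₁ × β₁) (α' × β')}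
    {G : SuperOp (α × β) (α' × β')} (hE : ∀ k, IsOperation (E k)) (hF : ∀ k, IsOperation (F k))
    (hG : IsOperation G) (h : IsSumOf (fun k => F k ∘ₗ E k) G) :
    IsSumOf (fun k => withSpectators (F k) (hF k) γ δ ∘ₗ withSpectators (E k) (hE k) γ δ)
      (withSpectators G hG γ δ) := fun ρ x y =>
  h (blockA (reindex (Equiv.prodProdProdComm α γ β δ).symm ρ) (x.1.2, x.2.2) (y.1.2, y.2.2))
    (x.1.1, x.2.1) (y.1.1, y.2.1)

/-- Each local measurement is extended by the identity on that party's own spectator; the other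
spectator is untouched, so every round keeps its form. -/
theorem LOCCRounds.withSpectators {α' β' : Type} {r : ℕ} {α β : Type}
    {G : SuperOp (α × β) (α' × β')} (h : LOCCRounds α' β' r α β G) (hG : IsOperation G)
    (γ δ : Type) :
    LOCCRounds (α' × γ) (β' × δ) r (α × γ) (β × δ) (withSpectators G hG γ δ) := by
  induction h with
  | done r => exact .done r
  | alice E Ê F G hE hÊ hF hsum ih =>
    have hEi := (hE.of_actsOnA hÊ).isOperation
    have hFi := fun k => (hF k).isChannel.isOperation
    exact .alice _ (fun k => SSR.withSpectators (Ê k) (hEi k) γ δ) _ _ (isInstrument_extend hE γ)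
      (fun k ρ x y => hÊ k _ _ _) (fun k => ih k (hFi k))
      (isSumOf_withSpectators hEi hFi hG hsum)
  | bob E Ê F G hE hÊ hF hsum ih =>
    have hEi := (hE.of_actsOnB hÊ).isOperation
    have hFi := fun k => (hF k).isChannel.isOperation
    exact .bob _ (fun k => SSR.withSpectators (Ê k) (hEi k) γ δ) _ _ (isInstrument_extend hE δ)
      (fun k ρ x y => hÊ k _ _ _) (fun k => ih k (hFi k))
      (isSumOf_withSpectators hEi hFi hG hsum)

theorem IsLOCC.withSpectators {α β α' β' : Type} {G : SuperOp (α × β) (α' × β')}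
    (h : IsLOCC G) (γ δ : Type) :
    IsLOCC (withSpectators G h.isChannel.isOperation γ δ) :=
  h.elim fun r h' => ⟨r, h'.withSpectators _ γ δ⟩

/-! ### The entanglement of distillation is an entanglement measure -/

theorem localMap_reindex_apply {α α' β β' : Type} (e : α' ≃ α) (f : β' ≃ β)
    (ρ : TraceClass (α × β)) :
    localMap (isChannel_reindex e) (isChannel_reindex f) ρ = reindex (e.prodCongr f) ρ := rfl

theorem reindex_prodComm_tensorBip {α β γ δ : Type} (ρ : TraceClass (α × β))
    (σ : TraceClass (γ × δ)) :
    reindex ((Equiv.prodComm γ α).prodCongr (Equiv.prodComm δ β)) (tensorBip ρ σ)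
      = tensorBip σ ρ := by
  ext x y
  exact mul_comm _ _

/-- `M ⊗ Λ` is `M` with spectators followed by `Λ` with spectators, with swaps in between and at the
end. Each party swaps only its own two factors, so the swaps are local. -/
theorem exists_isLOCC_tensorBip {α β α' β' γ δ γ' δ' : Type} {M : SuperOp (α × β) (α' × β')}
    {Λ : SuperOp (γ × δ) (γ' × δ')} (hM : IsLOCC M) (hΛ : IsLOCC Λ) :
    ∃ K : SuperOp ((α × γ) × (β × δ)) ((α' × γ') × (β' × δ')), IsLOCC K ∧
      ∀ σ ρ, K (tensorBip σ ρ) = tensorBip (M σ) (Λ ρ) := by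
  have hs := fun γ γ' δ δ' : Type => isLOCC_localMap
    (isChannel_reindex (Equiv.prodComm γ' γ)) (isChannel_reindex (Equiv.prodComm δ' δ))
  refine ⟨_, (hs γ' α' δ' β').comp ((hΛ.withSpectators α' β').comp ((hs α' γ β' δ).comp
    (hM.withSpectators γ δ))), fun σ ρ => ?_⟩
  simp only [LinearMap.comp_apply]
  rw [withSpectators_tensorBip, localMap_reindex_apply, localMap_reindex_apply,
    reindex_prodComm_tensorBip, withSpectators_tensorBip, reindex_prodComm_tensorBip]

theorem exists_isLOCC_tensorPow {α β α' β' : Type} {Λ : SuperOp (α × β) (α' × β')}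
    (hΛ : IsLOCC Λ) (ρ : TraceClass (α × β)) (n : ℕ) :
    ∃ M : SuperOp (TPow α n × TPow β n) (TPow α' n × TPow β' n), IsLOCC M ∧
      M (tensorPow ρ n) = tensorPow (Λ ρ) n := by
  induction n with
  | zero => exact ⟨LinearMap.id, isLOCC_id _ _, rfl⟩
  | succ n ih =>
    obtain ⟨M, hM, hMρ⟩ := ih
    obtain ⟨K, hK, hKρ⟩ := exists_isLOCC_tensorBip hM hΛ
    exact ⟨K, hK, (hKρ (tensorPow ρ n) ρ).trans (congrArg (tensorBip · (Λ ρ)) hMρ)⟩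

/-- A distillation protocol for `Λ ρ`, preceded by `n` copies of `Λ`, distills `ρ` at the same rate
with the same fidelities. -/
theorem isLOCCMonotone_distillableEnt : IsLOCCMonotone distillableEnt := by
  intro A B A' B' Λ hΛ ρ _
  refine iSup₂_le fun R hR => ?_
  refine le_iSup₂_of_le R ⟨hR.1, ?_⟩ le_rfl
  obtain ⟨T, hT, hlim⟩ := hR.2
  choose M hM hMρ using exists_isLOCC_tensorPow hΛ ρ
  refine ⟨fun n => T n ∘ₗ M n, fun n => (hT n).comp (hM n), ?_⟩
  simpa only [LinearMap.comp_apply, hMρ] using hlim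

/-! ### LOCC under the superselection rule -/

theorem twirlLoc_entry {α β : Type} (NA : α → ℕ) (NB : β → ℕ) (ρ : TraceClass (α × β))
    (x y : α × β) : (twirlLoc NA NB ρ).1 x y
      = if NA x.1 = NA y.1 then if NB x.2 = NB y.2 then ρ.1 x y else 0 else 0 := by
  simp only [twirlLoc, LinearMap.comp_apply, twirl_entry]

theorem isChannel_twirlLoc {α β : Type} (NA : α → ℕ) (NB : β → ℕ) :
    IsChannel (twirlLoc NA NB) := (isChannel_twirl _).comp (isChannel_twirl _)

theorem blockA_twirlLoc {α β : Type} (NA : α → ℕ) (NB : β → ℕ) (ρ : TraceClass (α × β))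
    (b b' : β) : blockA (twirlLoc NA NB ρ) b b'
      = if NB b = NB b' then twirl NA (blockA ρ b b') else 0 := by
  ext x y
  refine (twirlLoc_entry NA NB ρ (x, b) (y, b')).trans ?_
  by_cases h : NB b = NB b'
  · simp only [h, if_true, twirl_entry]
    rfl
  · simp [h]

theorem blockB_twirlLoc {α β : Type} (NA : α → ℕ) (NB : β → ℕ) (ρ : TraceClass (α × β))
    (a a' : α) : blockB (twirlLoc NA NB ρ) a a'
      = if NA a = NA a' then twirl NB (blockB ρ a a') else 0 := by
  ext x y
  refine (twirlLoc_entry NA NB ρ (a, x) (a', y)).trans ?_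
  by_cases h : NA a = NA a'
  · simp only [h, if_true, twirl_entry]
    rfl
  · simp [h]

theorem ActsOnA.comp_twirlLoc {α α' β : Type} {NA : α → ℕ} {NA' : α' → ℕ} (NB : β → ℕ)
    {E : SuperOp α α'} {F : SuperOp (α × β) (α' × β)} (h : ActsOnA E F)
    (hE : E ∘ₗ twirl NA = twirl NA' ∘ₗ E) : F ∘ₗ twirlLoc NA NB = twirlLoc NA' NB ∘ₗ F := by
  ext ρ x y
  rw [LinearMap.comp_apply, LinearMap.comp_apply, twirlLoc_entry, h, h, blockA_twirlLoc]
  by_cases hb : NB x.2 = NB y.2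
  · simp only [hb, if_true]
    rw [← LinearMap.comp_apply, hE, LinearMap.comp_apply, twirl_entry]
  · simp [hb]

theorem ActsOnB.comp_twirlLoc {α β β' : Type} (NA : α → ℕ) {NB : β → ℕ} {NB' : β' → ℕ}
    {E : SuperOp β β'} {F : SuperOp (α × β) (α × β')} (h : ActsOnB E F)
    (hE : E ∘ₗ twirl NB = twirl NB' ∘ₗ E) : F ∘ₗ twirlLoc NA NB = twirlLoc NA NB' ∘ₗ F := by
  ext ρ x y
  rw [LinearMap.comp_apply, LinearMap.comp_apply, twirlLoc_entry, h, h, blockB_twirlLoc]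
  by_cases hb : NA x.1 = NA y.1
  · simp only [hb, if_true]
    rw [← LinearMap.comp_apply, hE, LinearMap.comp_apply, twirl_entry]
  · simp [hb]

/-- The local twirl is a 0/1 mask on entries, so it passes through entrywise sums without any
continuity argument. -/
theorem IsSumOf.comp_twirlLoc {α β α₁ β₁ α' β' : Type} {NA : α → ℕ} {NB : β → ℕ}
    {NA₁ : α₁ → ℕ} {NB₁ : β₁ → ℕ} {NA' : α' → ℕ} {NB' : β' → ℕ}
    {E : ℕ → SuperOp (α × β) (α₁ × β₁)} {F : ℕ → SuperOp (α₁ × β₁) (α' × β')}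
    {G : SuperOp (α × β) (α' × β')} (h : IsSumOf (fun k => F k ∘ₗ E k) G)
    (hE : ∀ k, E k ∘ₗ twirlLoc NA NB = twirlLoc NA₁ NB₁ ∘ₗ E k)
    (hF : ∀ k, F k ∘ₗ twirlLoc NA₁ NB₁ = twirlLoc NA' NB' ∘ₗ F k) :
    G ∘ₗ twirlLoc NA NB = twirlLoc NA' NB' ∘ₗ G := by
  have hFE : ∀ k ρ, F k (E k (twirlLoc NA NB ρ)) = twirlLoc NA' NB' (F k (E k ρ)) := by
    intro k ρ
    have h1 := LinearMap.congr_fun (hE k) ρ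
    have h2 := LinearMap.congr_fun (hF k) (E k ρ)
    simp only [LinearMap.comp_apply] at h1 h2
    rw [h1, h2]
  ext ρ x y
  refine (h (twirlLoc NA NB ρ) x y).unique ?_
  have h1 := h ρ x y
  simp only [LinearMap.comp_apply, hFE, twirlLoc_entry] at h1 ⊢
  split_ifs
  · exact h1
  · exact hasSum_zero
  · exact hasSum_zero

theorem U1LOCCRounds.toLOCCRounds {α' β' : Type} {NA' : α' → ℕ} {NB' : β' → ℕ} {r : ℕ}
    {α β : Type} {NA : α → ℕ} {NB : β → ℕ} {G : SuperOp (α × β) (α' × β')}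
    (h : U1LOCCRounds NA' NB' r NA NB G) : LOCCRounds α' β' r α β G := by
  induction h with
  | done r => exact .done r
  | alice E Ê F G hE hU hÊ hF hG ih => exact .alice E Ê F G hE hÊ ih hG
  | bob E Ê F G hE hU hÊ hF hG ih => exact .bob E Ê F G hE hÊ ih hG

/-- Sense (a) of the superselection rule implies sense (b): commutation with the twirl holds in each
round and survives composition and summation over outcomes. -/
theorem U1LOCCRounds.comp_twirlLoc {α' β' : Type} {NA' : α' → ℕ} {NB' : β' → ℕ} {r : ℕ}
    {α β : Type} {NA : α → ℕ} {NB : β → ℕ} {G : SuperOp (α × β) (α' × β')}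
    (h : U1LOCCRounds NA' NB' r NA NB G) : G ∘ₗ twirlLoc NA NB = twirlLoc NA' NB' ∘ₗ G := by
  induction h with
  | done r => rfl
  | alice E Ê F G hE hU hÊ hF hG ih =>
    exact hG.comp_twirlLoc
      (fun k => (hÊ k).comp_twirlLoc _ ((hU k).comp_twirl (hE.isOperation k))) ih
  | bob E Ê F G hE hU hÊ hF hG ih =>
    exact hG.comp_twirlLoc
      (fun k => (hÊ k).comp_twirlLoc _ ((hU k).comp_twirl (hE.isOperation k))) ih

theorem IsU1Invariant.single {α α' : Type} {N : α → ℕ} {N' : α' → ℕ} {E : SuperOp α α'}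
    (h : IsU1Invariant N N' E) (k : ℕ) : IsU1Invariant N N' (if k = 0 then E else 0) := by
  split_ifs
  · exact h
  · intro φ
    rw [LinearMap.zero_comp, LinearMap.comp_zero]

theorem U1LOCCRounds.comp_alice {α α₁ β α' β' : Type} {NA' : α' → ℕ} {NB' : β' → ℕ} {r : ℕ}
    {NA : α → ℕ} {NA₁ : α₁ → ℕ} {NB : β → ℕ} {E : SuperOp α α₁}
    {Ê : SuperOp (α × β) (α₁ × β)} {F : SuperOp (α₁ × β) (α' × β')}
    (hF : U1LOCCRounds NA' NB' r NA₁ NB F) (hE : IsChannel E) (hU : IsU1Invariant NA NA₁ E)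
    (hÊ : ActsOnA E Ê) : U1LOCCRounds NA' NB' (r + 1) NA NB (F ∘ₗ Ê) :=
  .alice _ _ (fun _ => F) _ (isInstrument_single hE) hU.single hÊ.single (fun _ => hF)
    (isSumOf_single F Ê)

theorem U1LOCCRounds.comp_bob {α β β₁ α' β' : Type} {NA' : α' → ℕ} {NB' : β' → ℕ} {r : ℕ}
    {NA : α → ℕ} {NB : β → ℕ} {NB₁ : β₁ → ℕ} {E : SuperOp β β₁}
    {Ê : SuperOp (α × β) (α × β₁)} {F : SuperOp (α × β₁) (α' × β')}
    (hF : U1LOCCRounds NA' NB' r NA NB₁ F) (hE : IsChannel E) (hU : IsU1Invariant NB NB₁ E)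
    (hÊ : ActsOnB E Ê) : U1LOCCRounds NA' NB' (r + 1) NA NB (F ∘ₗ Ê) :=
  .bob _ _ (fun _ => F) _ (isInstrument_single hE) hU.single hÊ.single (fun _ => hF)
    (isSumOf_single F Ê)

theorem actsOnA_twirl {α β : Type} (NA : α → ℕ) :
    ActsOnA (twirl NA) (twirl fun x : α × β => NA x.1) := fun ρ x y => by
  rw [twirl_entry, twirl_entry]
  rfl

theorem actsOnB_twirl {α β : Type} (NB : β → ℕ) :
    ActsOnB (twirl NB) (twirl fun x : α × β => NB x.2) := fun ρ x y => by
  rw [twirl_entry, twirl_entry]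
  rfl

/-- The twirl respects the superselection rule even when its input is declared to carry no
photons. -/
theorem isU1Invariant_zero_twirl {α : Type} (N : α → ℕ) :
    IsU1Invariant (fun _ => 0) N (twirl N) := fun φ => by
  rw [phase_zero, phase_comp_twirl, LinearMap.comp_id]

/-- The twirl respects the superselection rule even when its output is declared to carry no
photons. -/
theorem isU1Invariant_twirl_zero {α : Type} (N : α → ℕ) :
    IsU1Invariant N (fun _ => 0) (twirl N) := fun φ => by
  rw [phase_zero, twirl_comp_phase, LinearMap.id_comp]

/-- All spaces inside the protocol get photon number zero, so its measurements are trivially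
invariant. At the end of each branch one twirl per party, hence two extra rounds, restores the
labels `NA'` and `NB'`. -/
theorem LOCCRounds.u1_twirlLoc_comp {α' β' : Type} (NA' : α' → ℕ) (NB' : β' → ℕ) {r : ℕ}
    {α β : Type} {G : SuperOp (α × β) (α' × β')} (h : LOCCRounds α' β' r α β G) :
    U1LOCCRounds NA' NB' (r + 2) (fun _ : α => 0) (fun _ : β => 0) (twirlLoc NA' NB' ∘ₗ G) := by
  induction h with
  | done r =>
    exact (((U1LOCCRounds.done r).comp_alice (isChannel_twirl _) (isU1Invariant_zero_twirl NA')
      (actsOnA_twirl NA')).comp_bob (isChannel_twirl _) (isU1Invariant_zero_twirl NB')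
      (actsOnB_twirl NB'))
  | alice E Ê F G hE hÊ hF hG ih =>
    exact .alice E Ê _ _ hE (fun k => isU1Invariant_zero (E k)) hÊ ih
      (hG.comp_left (hE.of_actsOnA hÊ) (fun k => (hF k).isChannel)
        (isChannel_twirlLoc NA' NB').isOperation)
  | bob E Ê F G hE hÊ hF hG ih =>
    exact .bob E Ê _ _ hE (fun k => isU1Invariant_zero (E k)) hÊ ih
      (hG.comp_left (hE.of_actsOnB hÊ) (fun k => (hF k).isChannel)
        (isChannel_twirlLoc NA' NB').isOperation)

/-- Every LOCC operation becomes `U(1)`-LOCC when it is preceded and followed by local twirls. -/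
theorem LOCCRounds.u1_twirlLoc_comp_twirlLoc {α β α' β' : Type} (NA : α → ℕ) (NB : β → ℕ)
    (NA' : α' → ℕ) (NB' : β' → ℕ) {r : ℕ} {G : SuperOp (α × β) (α' × β')}
    (h : LOCCRounds α' β' r α β G) :
    U1LOCCRounds NA' NB' (r + 4) NA NB (twirlLoc NA' NB' ∘ₗ G ∘ₗ twirlLoc NA NB) :=
  ((h.u1_twirlLoc_comp NA' NB').comp_alice (isChannel_twirl _) (isU1Invariant_twirl_zero NA)
    (actsOnA_twirl NA)).comp_bob (isChannel_twirl _) (isU1Invariant_twirl_zero NB)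
    (actsOnB_twirl NB)

/-! ### Register states producible under the superselection rule -/

section Registers

variable {SA SB RA RB : Type}

theorem u1LOCC_subset_commutingLOCC (NA : SA → ℕ) (NB : SB → ℕ) :
    u1LOCC NA NB RA RB ⊆ commutingLOCC NA NB RA RB := fun _ ⟨r, h⟩ =>
  ⟨⟨r, h.toLOCCRounds⟩, h.comp_twirlLoc⟩

/-- The trace uses only entries with equal system indices on both sides, and the twirl leaves these
alone. -/
theorem traceSys_twirlLoc (NA : SA → ℕ) (NB : SB → ℕ)
    (σ : TraceClass ((SA × RA) × (SB × RB))) :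
    traceSys (twirlLoc (fun x : SA × RA => NA x.1) (fun x : SB × RB => NB x.1) σ)
      = traceSys σ := by
  ext x y
  refine tsum_congr fun s => ?_
  have h := twirlLoc_entry (fun x : SA × RA => NA x.1) (fun x : SB × RB => NB x.1) σ
    ((s.1, x.1), (s.2, x.2)) ((s.1, y.1), (s.2, y.2))
  simp only [if_true] at h
  exact h

theorem tensorBip_twirlLoc (NA : SA → ℕ) (NB : SB → ℕ) (ρ : TraceClass (SA × SB))
    (σ : TraceClass (RA × RB)) : tensorBip (twirlLoc NA NB ρ) σ
      = twirlLoc (fun x : SA × RA => NA x.1) (fun x : SB × RB => NB x.1) (tensorBip ρ σ) := by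
  ext x y
  rw [twirlLoc_entry]
  have h : ∀ τ : TraceClass (SA × SB), (tensorBip τ σ).1 x y
      = τ.1 (x.1.1, x.2.1) (y.1.1, y.2.1) * σ.1 (x.1.2, x.2.2) (y.1.2, y.2.2) := fun _ => rfl
  rw [h, h, twirlLoc_entry]
  split_ifs <;> simp

/-- Under the superselection rule exactly those register states can be produced from `ρ` that
unconstrained LOCC operations produce from the twirled state. -/
theorem producible_eq (NA : SA → ℕ) (NB : SB → ℕ)
    {C : Set (SuperOp ((SA × RA) × (SB × RB)) ((SA × RA) × (SB × RB)))}
    (hC : C = u1LOCC NA NB RA RB ∨ C = commutingLOCC NA NB RA RB)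
    (E : TraceClass (RA × RB) → ℝ≥0∞) (a : ℓ²(RA, ℂ)) (b : ℓ²(RB, ℂ))
    (ρ : TraceClass (SA × SB)) :
    producible E C a b ρ
      = producible E (unconstrainedLOCC SA SB RA RB) a b (twirlLoc NA NB ρ) := by
  -- Both senses lie between the strict local one and the commuting one, so one inclusion is proved
  -- for the largest class and the other for the smallest.
  have hC₁ : C ⊆ commutingLOCC NA NB RA RB := by
    rcases hC with rfl | rfl
    exacts [u1LOCC_subset_commutingLOCC NA NB, subset_rfl]
  have hC₂ : u1LOCC NA NB RA RB ⊆ C := by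
    rcases hC with rfl | rfl
    exacts [subset_rfl, u1LOCC_subset_commutingLOCC NA NB]
  ext e
  constructor
  · rintro ⟨O, hO, rfl⟩
    refine ⟨O, (hC₁ hO).1, ?_⟩
    have h := LinearMap.congr_fun (hC₁ hO).2 (tensorBip ρ (tensor (pureState a) (pureState b)))
    simp only [LinearMap.comp_apply] at h
    rw [tensorBip_twirlLoc, h, traceSys_twirlLoc]
  · rintro ⟨Λ, ⟨r, hΛ⟩, rfl⟩
    -- The witness is `Λ` between local twirls, with two rounds for the twirls on each side. The
    -- first pair twirls the input, the last is invisible after the trace.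
    refine ⟨_, hC₂ ⟨r + 4, hΛ.u1_twirlLoc_comp_twirlLoc _ _ _ _⟩, ?_⟩
    simp only [LinearMap.comp_apply]
    rw [traceSys_twirlLoc, tensorBip_twirlLoc]

end Registers

/-! ### Moving a system into a larger register -/

theorem trace_tensor {α β : Type} (μ : TraceClass α) (ν : TraceClass β) :
    trace (tensor μ ν) = trace μ * trace ν := by
  have h : ∀ c, trace (blockA (tensor μ ν) c c) = trace μ * ν.1 c c := fun c =>
    tsum_mul_right (f := fun i => μ.1 i i) (a := ν.1 c c)
  refine (hasSum_trace_blockA (tensor μ ν)).unique ?_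
  simp only [h]
  exact (hasSum_trace ν).mul_left _

theorem ptraceFst_tensor {α β : Type} (μ : TraceClass α) (ν : TraceClass β) :
    ptraceFst (tensor μ ν) = trace μ • ν := by
  ext b b'
  exact tsum_mul_right (f := fun i => μ.1 i i) (a := ν.1 b b')

theorem reindex_prodComm_tensor {α β : Type} (μ : TraceClass α) (ν : TraceClass β) :
    reindex (Equiv.prodComm β α) (tensor μ ν) = tensor ν μ := by
  ext x y
  exact mul_comm _ _

theorem trace_pureState {ι : Type} {ψ : ℓ²(ι, ℂ)} (h : ‖ψ‖ = 1) : trace (pureState ψ) = 1 := by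
  have h1 := (lp.hasSum_inner (𝕜 := ℂ) ψ ψ).tsum_eq
  rw [inner_self_eq_norm_sq_to_K, h] at h1
  simp only [RCLike.inner_apply, RCLike.ofReal_one, one_pow] at h1
  exact h1

/-- Adding an ancilla in a pure state. -/
def appendPure {ι : Type} (α : Type) (ψ : ℓ²(ι, ℂ)) : SuperOp α (α × ι) where
  toFun ρ := tensor ρ (pureState ψ)
  map_add' ρ σ := by
    ext x y
    exact add_mul _ _ _
  map_smul' c ρ := by
    ext x y
    exact mul_assoc _ _ _

theorem isChannel_appendPure {ι α : Type} {ψ : ℓ²(ι, ℂ)} (h : ‖ψ‖ = 1) :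
    IsChannel (appendPure α ψ) := by
  refine ⟨isCP_of_hasSum (κ := Unit) (fun _ => Prod.fst) (fun _ x => ψ x.2) fun ρ x y => ?_,
    fun ρ => ?_⟩
  · have h1 := hasSum_unique (fun _ : Unit => ψ x.2 * ρ.1 x.1 y.1 * star (ψ y.2))
    have h2 : (appendPure α ψ ρ).1 x y = ρ.1 x.1 y.1 * (ψ x.2 * star (ψ y.2)) := rfl
    rw [h2]
    convert h1 using 1
    ring
  · exact (trace_tensor ρ _).trans (by rw [trace_pureState h, mul_one])

theorem trace_matrixUnit_self {ι : Type} (i : ι) : trace (matrixUnit i i) = 1 := by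
  refine (hasSum_trace _).unique ?_
  convert hasSum_single i (f := fun x => (matrixUnit i i).1 x x) ?_ using 1
  · simp [matrixUnit_apply]
  · intro x hx
    simp [matrixUnit_apply, Ne.symm hx]

/-! ### Isometric embeddings along injections of bases -/

section Embed

variable {κ ι : Type} [Nonempty κ] {f : κ → ι}

open Classical in
-- Off the range of `f` the value of `f.invFun` is arbitrary; the indicator factors remove it.
theorem isPosTC_embed (hf : f.Injective) {M : Matrix κ κ ℂ} (hM : IsPosTC M) :
    IsPosTC (Matrix.of fun i j => (if i ∈ Set.range f then 1 else 0)
      * M (f.invFun i) (f.invFun j) * star (if j ∈ Set.range f then 1 else 0)) := by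
  refine ⟨posSemidef_weighted hM.1 f.invFun fun i => if i ∈ Set.range f then 1 else 0, ?_⟩
  refine (hf.summable_iff fun i hi => by simp only [Matrix.of_apply, if_neg hi, zero_mul]).mp ?_
  refine hM.2.congr fun k => ?_
  simp [Function.leftInverse_invFun hf k]

open Classical in
/-- The isometric embedding `ρ ↦ V ρ V†` with `V |k⟩ = |f k⟩`. -/
def embed (hf : f.Injective) : SuperOp κ ι where
  toFun ρ := ⟨Matrix.of fun i j => (if i ∈ Set.range f then 1 else 0)
      * ρ.1 (f.invFun i) (f.invFun j) * star (if j ∈ Set.range f then 1 else 0), by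
    let F : Matrix κ κ ℂ →ₗ[ℂ] Matrix ι ι ℂ :=
      { toFun := fun M => Matrix.of fun i j => (if i ∈ Set.range f then 1 else 0)
          * M (f.invFun i) (f.invFun j) * star (if j ∈ Set.range f then 1 else 0)
        map_add' := fun M M' => by
          ext i j
          simp only [Matrix.of_apply, Matrix.add_apply]
          ring
        map_smul' := fun c M => by
          ext i j
          simp only [Matrix.of_apply, Matrix.smul_apply, smul_eq_mul, RingHom.id_apply]
          ring }
    exact map_mem F (fun M hM => (isPosTC_embed hf hM).mem) ρ.2⟩
  map_add' ρ σ := by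
    ext i j
    simp only [Matrix.of_apply, Submodule.coe_add, Matrix.add_apply]
    ring
  map_smul' c ρ := by
    ext i j
    simp only [Matrix.of_apply, SetLike.val_smul, Matrix.smul_apply, smul_eq_mul, RingHom.id_apply]
    ring

open Classical in
theorem embed_apply (hf : f.Injective) (ρ : TraceClass κ) (i j : ι) :
    (embed hf ρ).1 i j = (if i ∈ Set.range f then 1 else 0)
      * ρ.1 (f.invFun i) (f.invFun j) * star (if j ∈ Set.range f then 1 else 0) := rfl

theorem isChannel_embed (hf : f.Injective) : IsChannel (embed hf) := by
  classical
  refine ⟨isCP_of_hasSum (κ := Unit) (fun _ => f.invFun)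
    (fun _ i => if i ∈ Set.range f then 1 else 0) fun ρ i j => ?_, fun ρ => ?_⟩
  · exact hasSum_unique (fun _ : Unit => (embed hf ρ).1 i j)
  · refine (hasSum_trace _).unique ((hf.hasSum_iff fun i hi => by simp [embed_apply, hi]).mp ?_)
    convert hasSum_trace ρ using 2 with k
    simp [embed_apply, Function.leftInverse_invFun hf k]

theorem embed_matrixUnit (hf : f.Injective) (k l : κ) :
    embed hf (matrixUnit k l) = matrixUnit (f k) (f l) := by
  ext i j
  rw [embed_apply]
  by_cases hi : i ∈ Set.range f
  · by_cases hj : j ∈ Set.range f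
    · obtain ⟨k', rfl⟩ := hi
      obtain ⟨l', rfl⟩ := hj
      simp only [Set.mem_range_self, if_true, matrixUnit_apply, one_mul, star_one, mul_one,
        Function.leftInverse_invFun hf _]
      have e : (f k = f k' ∧ f l = f l') ↔ k = k' ∧ l = l' := and_congr hf.eq_iff hf.eq_iff
      by_cases h : k = k' ∧ l = l'
      · rw [if_pos h, if_pos (e.mpr h)]
      · rw [if_neg h, if_neg (mt e.mp h)]
    · have : f l ≠ j := fun h => hj ⟨l, h⟩
      simp [matrixUnit_apply, hj, this]
  · have : f k ≠ i := fun h => hi ⟨k, h⟩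
    simp [matrixUnit_apply, hi, this]

end Embed

/-- If the register `R` is at least as large as the system `S`, there is a channel that moves the
state of the system into the register, from where it can be recovered. -/
theorem exists_move_to_register {S R : Type} [Nonempty S] (h : Cardinal.mk S ≤ Cardinal.mk R)
    {a : ℓ²(R, ℂ)} (ha : ‖a‖ = 1) :
    ∃ (T : SuperOp (S × R) (S × R)) (D : SuperOp R S), IsChannel T ∧ IsChannel D ∧
      ∀ μ, D (ptraceFst (T (tensor μ (pureState a)))) = μ := by
  classical
  obtain ⟨⟨f, hf⟩⟩ : Nonempty (S ↪ R) := h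
  obtain ⟨s₀⟩ := ‹Nonempty S›
  have : Nonempty R := ⟨f s₀⟩
  -- `T` will discard the initial register state and write `s` as `|s₀, f s⟩`, leaving the system in
  -- a fixed state.
  have hk : Function.Injective fun s => (s₀, f s) := fun s s' e => hf (Prod.ext_iff.mp e).2
  -- `q` is the isometry behind the recovery `D`: it sends `f s` to `(s, f s₀)`, so discarding the
  -- second factor leaves `s`. Other register states go to `(s₀, r)`, which cannot collide because
  -- `f s₀` is in the range of `f` and `r` is not.
  let q : R → S × R := fun r => if r ∈ Set.range f then (f.invFun r, f s₀) else (s₀, r)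
  have hqf : ∀ s, q (f s) = (s, f s₀) := fun s => by
    simp [q, Function.leftInverse_invFun hf s]
  have hqn : ∀ r, r ∉ Set.range f → q r = (s₀, r) := fun r hr => if_neg hr
  have hq : q.Injective := by
    intro r r' e
    by_cases hr : r ∈ Set.range f <;> by_cases hr' : r' ∈ Set.range f
    · obtain ⟨s, rfl⟩ := hr
      obtain ⟨s', rfl⟩ := hr'
      rw [hqf, hqf] at e
      exact congrArg f (Prod.ext_iff.mp e).1
    · obtain ⟨s, rfl⟩ := hr
      rw [hqf, hqn _ hr'] at e
      exact absurd ⟨s₀, (Prod.ext_iff.mp e).2⟩ hr'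
    · obtain ⟨s, rfl⟩ := hr'
      rw [hqf, hqn _ hr] at e
      exact absurd ⟨s₀, (Prod.ext_iff.mp e).2.symm⟩ hr
    · rw [hqn _ hr, hqn _ hr'] at e
      exact (Prod.ext_iff.mp e).2
  have hsnd : ∀ α β : Type,
      IsChannel ((ptraceFst : SuperOp (β × α) α) ∘ₗ reindex (Equiv.prodComm β α)) :=
    fun _ _ => isChannel_ptraceFst.comp (isChannel_reindex _)
  have hT := (isChannel_embed hk).comp (hsnd S R)
  have hD := (hsnd S R).comp (isChannel_embed hq)
  refine ⟨_, _, hT, hD, ?_⟩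
  have hid : ((ptraceFst ∘ₗ reindex (Equiv.prodComm R S)) ∘ₗ embed hq) ∘ₗ
      (ptraceFst : SuperOp (S × R) R) ∘ₗ embed hk = LinearMap.id := by
    refine (hD.comp (isChannel_ptraceFst.comp (isChannel_embed hk))).isOperation.ext_matrixUnit
      (isChannel_id S).isOperation fun s s' => ?_
    simp only [LinearMap.comp_apply, embed_matrixUnit, matrixUnit_prod (s₀, _), ptraceFst_tensor,
      trace_matrixUnit_self, one_smul, hqf, matrixUnit_prod (_, f s₀), reindex_prodComm_tensor,
      LinearMap.id_apply]
  intro μ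
  have h1 := LinearMap.congr_fun hid μ
  simp only [LinearMap.comp_apply, LinearMap.id_apply] at h1 ⊢
  rw [reindex_prodComm_tensor, ptraceFst_tensor, trace_pureState ha, one_smul, h1]

/-! ### Optimal transfer of entanglement into the registers -/

section Registers

variable {SA SB RA RB : Type}

theorem isChannel_traceSys :
    IsChannel (traceSys : SuperOp ((SA × RA) × (SB × RB)) (RA × RB)) :=
  isChannel_ptraceFst.comp (isChannel_reindex _)

theorem traceSys_tensor (μ : TraceClass (SA × RA)) (ν : TraceClass (SB × RB)) :
    traceSys (tensor μ ν) = tensor (ptraceFst μ) (ptraceFst ν) := by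
  ext x y
  exact (tsum_mul_tsum_of_summable_norm (summable_ptrace μ.2 x.1 y.1).norm
    (summable_ptrace ν.2 x.2 y.2).norm).symm

/-- Each party discards its own system; agreement of the joint trace with these two local channels
need only be checked on product operators. -/
theorem isLOCC_traceSys : IsLOCC (traceSys : SuperOp ((SA × RA) × (SB × RB)) (RA × RB)) := by
  rw [isChannel_traceSys.eq_localMap isChannel_ptraceFst isChannel_ptraceFst traceSys_tensor]
  exact isLOCC_localMap _ _

theorem localMap_appendPure {a : ℓ²(RA, ℂ)} {b : ℓ²(RB, ℂ)} (ha : ‖a‖ = 1) (hb : ‖b‖ = 1)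
    (ρ : TraceClass (SA × SB)) :
    localMap (isChannel_appendPure (α := SA) ha) (isChannel_appendPure (α := SB) hb) ρ
      = tensorBip ρ (tensor (pureState a) (pureState b)) := by
  ext x y
  exact mul_assoc _ _ _

/-- For an entanglement measure `E`, the largest entanglement that LOCC operations produce between
sufficiently large registers from the state `ρ` is `E ρ`. -/
theorem isGreatest_producible (hA : Cardinal.mk SA ≤ Cardinal.mk RA)
    (hB : Cardinal.mk SB ≤ Cardinal.mk RB) {ρ : TraceClass (SA × SB)} (hρ : IsState ρ)
    {a : ℓ²(RA, ℂ)} {b : ℓ²(RB, ℂ)} (ha : ‖a‖ = 1) (hb : ‖b‖ = 1)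
    {E : ∀ A B : Type, TraceClass (A × B) → ℝ≥0∞} (hE : IsLOCCMonotone E) :
    IsGreatest (producible (E RA RB) (unconstrainedLOCC SA SB RA RB) a b ρ) (E SA SB ρ) := by
  have happ := isLOCC_localMap (isChannel_appendPure (α := SA) ha)
    (isChannel_appendPure (α := SB) hb)
  have hle : ∀ e ∈ producible (E RA RB) (unconstrainedLOCC SA SB RA RB) a b ρ, e ≤ E SA SB ρ := by
    rintro _ ⟨Λ, hΛ, rfl⟩
    rw [← localMap_appendPure ha hb]
    exact hE _ _ _ _ _ (isLOCC_traceSys.comp (IsLOCC.comp hΛ happ)) ρ hρ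
  refine ⟨?_, hle⟩
  -- Embeddings need a nonempty index set; over an empty one the trace could not be `1`.
  have hne : Nonempty (SA × SB) := by
    by_contra hne
    rw [not_nonempty_iff] at hne
    have h := hρ.2
    rw [← (hasSum_trace ρ).tsum_eq, tsum_empty] at h
    exact zero_ne_one h
  obtain ⟨⟨s, t⟩⟩ := hne
  have : Nonempty SA := ⟨s⟩
  have : Nonempty SB := ⟨t⟩
  obtain ⟨TA, DA, hTA, hDA, hA'⟩ := exists_move_to_register hA ha
  obtain ⟨TB, DB, hTB, hDB, hB'⟩ := exists_move_to_register hB hb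
  have hO := isLOCC_localMap hTA hTB
  refine ⟨localMap hTA hTB, hO, le_antisymm ?_ (hle _ ⟨_, hO, rfl⟩)⟩
  rw [← localMap_appendPure ha hb]
  set K := traceSys ∘ₗ localMap hTA hTB ∘ₗ
    localMap (isChannel_appendPure (α := SA) ha) (isChannel_appendPure (α := SB) hb) with hK
  have hKc : IsChannel K := isChannel_traceSys.comp (hO.isChannel.comp happ.isChannel)
  -- The local recoveries undo `K` on product operators, hence on entangled states by normality. As
  -- they are LOCC too, monotonicity gives the reverse inequality.
  have hid : localMap hDA hDB ∘ₗ K = LinearMap.id := by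
    refine ((isLOCC_localMap hDA hDB).isChannel.comp hKc).isOperation.ext_tensor
      (isChannel_id _).isOperation fun μ ν => ?_
    simp only [hK, LinearMap.comp_apply, localMap_tensor, traceSys_tensor, LinearMap.id_apply]
    exact congrArg₂ tensor (hA' μ) (hB' ν)
  have h := hE _ _ _ _ _ (isLOCC_localMap hDA hDB) (K ρ) (hKc.isState hρ)
  rwa [← LinearMap.comp_apply, hid, LinearMap.id_apply] at h

end Registers

end SSR
end

/-! ### The main theorem -/

theorem mainTheorem5 {SA SB RA RB : Type} (NA : SA → ℕ) (NB : SB → ℕ)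
    (hA : Cardinal.mk SA ≤ Cardinal.mk RA) (hB : Cardinal.mk SB ≤ Cardinal.mk RB)
    (ρ : SSR.TraceClass (SA × SB)) (hρ : SSR.IsState ρ)
    (a : ℓ²(RA, ℂ)) (b : ℓ²(RB, ℂ)) (ha : ‖a‖ = 1) (hb : ‖b‖ = 1)
    (C : Set (SSR.SuperOp ((SA × RA) × (SB × RB)) ((SA × RA) × (SB × RB))))
    (hC : C = SSR.u1LOCC NA NB RA RB ∨ C = SSR.commutingLOCC NA NB RA RB) :
    (∀ E : SSR.TraceClass (RA × RB) → ℝ≥0∞,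
      SSR.maxEnt E C a b ρ
        = SSR.maxEnt E (SSR.unconstrainedLOCC SA SB RA RB) a b (SSR.twirlLoc NA NB ρ)) ∧
    (∀ E : ∀ A B : Type, SSR.TraceClass (A × B) → ℝ≥0∞, SSR.IsLOCCMonotone E →
      SSR.maxEnt (E RA RB) C a b ρ = E SA SB (SSR.twirlLoc NA NB ρ) ∧
      IsGreatest (SSR.producible (E RA RB) C a b ρ) (E SA SB (SSR.twirlLoc NA NB ρ))) ∧
    (SSR.maxEnt (SSR.distillableEnt RA RB) C a b ρ
        = SSR.distillableEnt SA SB (SSR.twirlLoc NA NB ρ) ∧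
      IsGreatest (SSR.producible (SSR.distillableEnt RA RB) C a b ρ)
        (SSR.distillableEnt SA SB (SSR.twirlLoc NA NB ρ))) := by
  have hE : ∀ E : ∀ A B : Type, SSR.TraceClass (A × B) → ℝ≥0∞, SSR.IsLOCCMonotone E →
      SSR.maxEnt (E RA RB) C a b ρ = E SA SB (SSR.twirlLoc NA NB ρ) ∧
      IsGreatest (SSR.producible (E RA RB) C a b ρ) (E SA SB (SSR.twirlLoc NA NB ρ)) := by
    intro E hE
    have h := SSR.isGreatest_producible hA hB ((SSR.isChannel_twirlLoc NA NB).isState hρ) ha hb hE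
    rw [← SSR.producible_eq NA NB hC] at h
    exact ⟨h.isLUB.sSup_eq, h⟩
  refine ⟨fun E => ?_, hE, hE _ SSR.isLOCCMonotone_distillableEnt⟩
  rw [SSR.maxEnt, SSR.maxEnt, SSR.producible_eq NA NB hC]
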